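/- Let $0<m<n$ be integers and $p>m$ a real number. Write $\mathbb{B}(x,r)$ for open and $\overline{\mathbb{B}}(x,r)$ for closed balls in $\mathbb{R}^n$, $G(n,m)$ for the set of $m$-dimensional linear subspaces of $\mathbb{R}^n$, and $\mathcal{H}^m$ for the $m$-dimensional Hausdorff measure. For $\Sigma\subset\mathbb{R}^n$, $x\in\Sigma$ and $r>0$ put $$\beta_\Sigma(x,r)=\frac1r\inf_{H\in G(n,m)}\ \sup_{z\in\Sigma\cap\mathbb{B}(x,r)}\operatorname{dist}(z,x+H),\qquad \theta_\Sigma(x,r)=\frac1r\inf_{H\in G(n,m)} d_{\mathcal H}\bigl(\Sigma\cap\overline{\mathbb{B}}(x,r),(x+H)\cap\overline{\mathbb{B}}(x,r)\bigr),$$ where $d_{\mathcal H}(E,F)=\sup_{y\in E}\operatorname{dist}(y,F)+\sup_{z\in F}\operatorname{dist}(z,E)$. A compact set $\Sigma$ is *$m$-fine* with constants $A_\Sigma>0$ and $M_\Sigma\ge2$ if for all $x\in\Sigma$ and $0<r\le\operatorname{diam}\Sigma$ $$\mathcal{H}^m(\Sigma\cap\mathbb{B}(x,r))\ge A_\Sigma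 r^m\qquad\text{and}\qquad \theta_\Sigma(x,r)\le M_\Sigma\,\beta_\Sigma(x,r).$$ The global Menger curvature of $\Sigma$ at $x$ is $$\mathcal{K}^{(1)}(x)=\mathcal{K}_G(x)=\sup_{x_1,\dots,x_{m+1}\in\Sigma}\frac{\mathcal{H}^{m+1}(\operatorname{conv}\{x,x_1,\dots,x_{m+1}\})}{\operatorname{diam}(\{x,x_1,\dots,x_{m+1}\})^{m+2}}$$ (the quotient being $0$ if all the points coincide), and, for an arbitrary map $H\colon\Sigma\to G(n,m)$, the global tangent-point curvature is $$\mathcal{K}^{(2)}(x)=\mathcal{K}_{\rm tp}(x)=\sup_{y\in\Sigma}\frac{2\operatorname{dist}(y,x+H(x))}{|y-x|^2}$$ (the quotient being $0$ if $y\in x+H(x)$). Set $$\kappa_1=\frac{p-m}{p(m+1)+2m},\qquad \kappa_2=\frac{p-m}{p+m}.$$ **Corollary ($C^{1,\kappa}$ estimates, first version).** Let $\Sigma\subset\mathbb{R}^n$ be an $m$-fine set with constants $A_\Sigma,M_\Sigma$ and with $\operatorname{diam}\Sigma>0$. Suppose that, for $i=1$, or for $i=2$ and some map $H\colon\Sigma\to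 G(n,m)$, $$\int_\Sigma \mathcal{K}^{(i)}(z)^p\,d\mathcal{H}^m(z)\le E<\infty.$$ Then $\Sigma$ is an embedded closed (compact, without boundary) $m$-dimensional manifold of class $C^{1,\kappa_i}$. Moreover, there are a radius $R>0$ and a constant $K$, both depending only on $n,m,p,A_\Sigma,M_\Sigma,E$ and $\operatorname{diam}\Sigma$, such that for each $x\in\Sigma$, with $P:=T_x\Sigma\in G(n,m)$, there is a function $f_x\colon P\to P^\perp$ of class $C^{1,\kappa_i}$ with $f_x(0)=0$, $Df_x(0)=0$, $$\Sigma\cap\mathbb{B}(x,R)=x+\bigl(\operatorname{graph}f_x\cap\mathbb{B}(0,R)\bigr),$$ where $\operatorname{graph}f_x=\{\xi+f_x(\xi):\xi\in P\}\subset\mathbb{R}^n$, and $$\|Df_x\|_{C^{0,\kappa_i}}\le K\quad\text{on the closed ball } \{\xi\in P:|\xi|\le R\},$$ where the $C^{0,\kappa_i}$ norm is the supremum norm plus the Hölder seminorm with exponent $\kappa_i$. -/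

import Mathlib

open MeasureTheory Metric Set
open scoped ENNReal NNReal

noncomputable section

namespace FineSets

/-- The Grassmannian of `m`-dimensional linear subspaces of `ℝⁿ`. -/
def Gr (n m : ℕ) : Set (Submodule ℝ (EuclideanSpace ℝ (Fin n))) :=
  {H | Module.finrank ℝ H = m}

/-- The affine plane `x + H`. -/
def plane {n : ℕ} (x : EuclideanSpace ℝ (Fin n))
    (H : Submodule ℝ (EuclideanSpace ℝ (Fin n))) : Set (EuclideanSpace ℝ (Fin n)) :=
  (fun v => x + v) '' (H : Set (EuclideanSpace ℝ (Fin n)))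

/-- The beta number: `r⁻¹` times the infimum over `H` in the Grassmannian of
`sup {dist (z, x + H) : z ∈ S ∩ B(x, r)}`, with the open ball. -/
def beta {n : ℕ} (m : ℕ) (S : Set (EuclideanSpace ℝ (Fin n)))
    (x : EuclideanSpace ℝ (Fin n)) (r : ℝ) : ℝ≥0∞ :=
  (⨅ H ∈ Gr n m, ⨆ z ∈ S ∩ ball x r, infEDist z (plane x H)) / ENNReal.ofReal r

/-- The Hausdorff distance in its additive form (the sum of the two one-sided distances). -/
def sumHausdorffDist {n : ℕ} (E F : Set (EuclideanSpace ℝ (Fin n))) : ℝ≥0∞ :=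
  (⨆ y ∈ E, infEDist y F) + ⨆ z ∈ F, infEDist z E

/-- The bilateral beta number, with closed balls. -/
def theta {n : ℕ} (m : ℕ) (S : Set (EuclideanSpace ℝ (Fin n)))
    (x : EuclideanSpace ℝ (Fin n)) (r : ℝ) : ℝ≥0∞ :=
  (⨅ H ∈ Gr n m, sumHausdorffDist (S ∩ closedBall x r) (plane x H ∩ closedBall x r)) /
    ENNReal.ofReal r

/-- `S` is an `m`-fine set with constants `A` and `M`. Here `μHE[m]` is the `m`-dimensional
Hausdorff measure, normalised to agree with Lebesgue measure on `ℝᵐ`. -/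
structure IsFineWith {n : ℕ} (m : ℕ) (A M : ℝ) (S : Set (EuclideanSpace ℝ (Fin n))) : Prop where
  isCompact : IsCompact S
  A_pos : 0 < A
  two_le_M : 2 ≤ M
  ahlfors : ∀ x ∈ S, ∀ r : ℝ, 0 < r → r ≤ diam S →
    ENNReal.ofReal (A * r ^ m) ≤ μHE[m] (S ∩ ball x r)
  holes : ∀ x ∈ S, ∀ r : ℝ, 0 < r → r ≤ diam S →
    theta m S x r ≤ ENNReal.ofReal M * beta m S x r

/-- The discrete Menger-type curvature `K(x, x₁, …, xₘ₊₁)`: the `(m+1)`-volume of the simplex over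
the `(m+2)`-nd power of its diameter. If all the points coincide, the value is `0 / 0 = 0`. -/
def simplexCurvature {n : ℕ} (m : ℕ) (x : EuclideanSpace ℝ (Fin n))
    (y : Fin (m + 1) → EuclideanSpace ℝ (Fin n)) : ℝ≥0∞ :=
  μHE[m + 1] (convexHull ℝ (insert x (range y))) / ediam (insert x (range y)) ^ (m + 2)

/-- The global Menger curvature of `S` at `x`. -/
def globalMenger {n : ℕ} (m : ℕ) (S : Set (EuclideanSpace ℝ (Fin n)))
    (x : EuclideanSpace ℝ (Fin n)) : ℝ≥0∞ :=
  ⨆ (y : Fin (m + 1) → EuclideanSpace ℝ (Fin n)) (_ : ∀ i, y i ∈ S), simplexCurvature m x y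

open Classical in
/-- The tangent-point radius `|y - x|² / (2 dist (y, x + H))`, infinite if `y ∈ x + H`. -/
def tangentPointRadius {n : ℕ} (x y : EuclideanSpace ℝ (Fin n))
    (H : Submodule ℝ (EuclideanSpace ℝ (Fin n))) : ℝ≥0∞ :=
  if y ∈ plane x H then ⊤ else edist y x ^ 2 / (2 * infEDist y (plane x H))

/-- The global tangent-point curvature of `S` at `x` with respect to the choice of planes `H`. -/
def globalTangentPoint {n : ℕ} (S : Set (EuclideanSpace ℝ (Fin n)))
    (H : EuclideanSpace ℝ (Fin n) → Submodule ℝ (EuclideanSpace ℝ (Fin n)))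
    (x : EuclideanSpace ℝ (Fin n)) : ℝ≥0∞ :=
  ⨆ y ∈ S, (tangentPointRadius x y (H x))⁻¹

/-- The exponent `κ₁` (the argument is positive for `p > m`). -/
def kappaMenger (m : ℕ) (p : ℝ) : ℝ≥0 := Real.toNNReal ((p - m) / (p * (m + 1) + 2 * m))

/-- The exponent `κ₂` (the argument is positive for `p > m`). -/
def kappaTangentPoint (m : ℕ) (p : ℝ) : ℝ≥0 := Real.toNNReal ((p - m) / (p + m))

/-- `f` is of class `C^{1,κ}` on the open set `U`: it is continuously differentiable there and its
derivative is Hölder continuous on `U` with exponent `κ`. -/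
def IsC1HolderOn {V W : Type*} [NormedAddCommGroup V] [NormedSpace ℝ V] [NormedAddCommGroup W]
    [NormedSpace ℝ W] (κ : ℝ≥0) (f : V → W) (U : Set V) : Prop :=
  ContDiffOn ℝ 1 f U ∧ ∃ L : ℝ≥0, HolderOnWith L κ (fderiv ℝ f) U

/-- The `C^{0,κ}` norm of `g` on `U`: the supremum of `‖g‖` plus the Hölder seminorm. -/
def c0HolderNormOn {V W : Type*} [PseudoEMetricSpace V] [NormedAddCommGroup W]
    (κ : ℝ≥0) (g : V → W) (U : Set V) : ℝ≥0∞ :=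
  (⨆ ξ ∈ U, ‖g ξ‖ₑ) + eHolderNorm κ (U.domRestrict g)

/-- The graph of `f : P → Pᗮ` as a subset of `ℝⁿ = P ⊕ Pᗮ`. -/
def graphOver {n : ℕ} (P : Submodule ℝ (EuclideanSpace ℝ (Fin n))) (f : P → Pᗮ) :
    Set (EuclideanSpace ℝ (Fin n)) :=
  range fun ξ : P => (ξ : EuclideanSpace ℝ (Fin n)) + (f ξ : EuclideanSpace ℝ (Fin n))

/-- In the ball `B(x, r)` the set `S` coincides with the translate by `x` of the graph of `f`. -/
def IsGraphNear {n : ℕ} (S : Set (EuclideanSpace ℝ (Fin n))) (x : EuclideanSpace ℝ (Fin n))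
    (r : ℝ) (P : Submodule ℝ (EuclideanSpace ℝ (Fin n))) (f : P → Pᗮ) : Prop :=
  S ∩ ball x r = (fun v => x + v) '' (graphOver P f ∩ ball 0 r)

/-- `S` is an embedded closed (that is, compact and without boundary) `m`-dimensional manifold of
class `C^{1,κ}` in `ℝⁿ`: near each of its points it is the graph of a `C^{1,κ}` function over an
open piece of an `m`-plane. -/
def IsClosedC1HolderManifold {n : ℕ} (m : ℕ) (κ : ℝ≥0)
    (S : Set (EuclideanSpace ℝ (Fin n))) : Prop :=
  IsCompact S ∧ ∀ x ∈ S, ∃ P ∈ Gr n m, ∃ r : ℝ, 0 < r ∧ ∃ f : P → Pᗮ,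
    IsC1HolderOn κ f (ball 0 r) ∧ IsGraphNear S x r P f

/-- The tangent space `T_x S`, spanned by the tangent directions (limits of rescaled secants)
of `S` at `x`. -/
def tangentSpaceAt {n : ℕ} (S : Set (EuclideanSpace ℝ (Fin n)))
    (x : EuclideanSpace ℝ (Fin n)) : Submodule ℝ (EuclideanSpace ℝ (Fin n)) :=
  Submodule.span ℝ (tangentConeAt ℝ S x)

/-- `S` is, near `x` and at scale `R`, the graph of a `C^{1,κ}` function `f` over `T_x S` with
`f(0) = 0` and `Df(0) = 0`, whose derivative has `C^{0,κ}` norm at most `K` on the closed ball of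
radius `R` of `T_x S`. -/
def HasGraphPatch {n : ℕ} (m : ℕ) (κ : ℝ≥0) (R K : ℝ) (S : Set (EuclideanSpace ℝ (Fin n)))
    (x : EuclideanSpace ℝ (Fin n)) : Prop :=
  tangentSpaceAt S x ∈ Gr n m ∧
    ∃ f : tangentSpaceAt S x → (tangentSpaceAt S x)ᗮ,
      IsC1HolderOn κ f univ ∧ f 0 = 0 ∧ fderiv ℝ f 0 = 0 ∧
      IsGraphNear S x R (tangentSpaceAt S x) f ∧
      c0HolderNormOn κ (fderiv ℝ f) (closedBall 0 R) ≤ ENNReal.ofReal K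

end FineSets

end

/-! The integral bound controls flatness at every scale. By the lower bound on the measure, each
ball `B(x,r)` contains some `z ∈ S` with `𝒦(z) ≤ Λ`, where `Λ` is of order `r^(-m/p)`
(`IsFineWith.exists_le_of_lintegral_le`). As the curvatures are suprema over all of `S`, this single
value controls all of `S ∩ B(x,r)`. In the tangent-point case the distance to `z + H(z)` is at most
`2Λr²`. In the Menger case, a set far from every `m`-plane through `z` would contain, with `z`, the
vertices of an `(m+1)`-simplex too large for the curvature bound. Hence `β` decays like `r^a`, with
`a = 1 - m/p` or `a = (1 - m/p)/(m+1)`. Both are at least `κᵢ`, and the surplus power is absorbed by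
the diameter.

Fineness turns this into bilateral flatness, `HasFlatApprox`. The approximating planes at dyadic
scales then form a Cauchy sequence; the limits are tangent planes depending on the point in a Hölder
continuous way (`exists_hasTangentPlanes`). Projection to the tangent plane at `x` is injective on
`S` near `x` because nearby tangent planes are almost parallel, and it covers a ball because `S` is
compact and has no holes. Its inverse parametrises a graph, whose derivative at the base point of
`y` is the linear map with graph `H y` (`HasTangentPlanes.exists_local_graph`). Composition with a
cutoff makes the graph function global. -/

namespace FineSets

/-! ### Distances between subspaces, measured by orthogonal projections -/

section Projections

variable {E : Type*} [NormedAddCommGroup E] [InnerProductSpace ℝ E]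

theorem norm_sub_starProjection_le_of_mem (P : Submodule ℝ E) [P.HasOrthogonalProjection] (v : E)
    {h : E} (hh : h ∈ P) : ‖v - P.starProjection v‖ ≤ ‖v - h‖ := by
  rw [Submodule.starProjection_minimal]
  exact ciInf_le ⟨0, by rintro _ ⟨x, rfl⟩; positivity⟩ (⟨h, hh⟩ : P)

theorem norm_sub_starProjection_le (P : Submodule ℝ E) [P.HasOrthogonalProjection] (v : E) :
    ‖v - P.starProjection v‖ ≤ ‖v‖ := by
  simpa using norm_sub_starProjection_le_of_mem P v P.zero_mem

theorem norm_sub_starProjection_add_le (P : Submodule ℝ E) [P.HasOrthogonalProjection] (u v : E) :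
    ‖(u + v) - P.starProjection (u + v)‖ ≤
      ‖u - P.starProjection u‖ + ‖v - P.starProjection v‖ := by
  rw [map_add, add_sub_add_comm]
  exact norm_add_le _ _

/-- With `w = u - Pu`, the difference at `u` is `(Pu - QPu) - Qw`. The first term is small by `hPQ`.
For `q = Qw`, orthogonality of `w` to `P` gives `‖q‖² = ⟨q - Pq, w⟩ ≤ ε‖q‖‖w‖` by `hQP`. -/
theorem norm_starProjection_sub_le (P Q : Submodule ℝ E) [P.HasOrthogonalProjection]
    [Q.HasOrthogonalProjection] {ε : ℝ} (hε : 0 ≤ ε)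
    (hPQ : ∀ v ∈ P, ‖v - Q.starProjection v‖ ≤ ε * ‖v‖)
    (hQP : ∀ v ∈ Q, ‖v - P.starProjection v‖ ≤ ε * ‖v‖) :
    ‖P.starProjection - Q.starProjection‖ ≤ 2 * ε := by
  refine ContinuousLinearMap.opNorm_le_bound _ (by positivity) fun u => ?_
  set w := u - P.starProjection u with hw
  have hw_le : ‖w‖ ≤ ‖u‖ := norm_sub_starProjection_le P u
  have h1 : (P.starProjection - Q.starProjection) u =
      (P.starProjection u - Q.starProjection (P.starProjection u)) - Q.starProjection w := by
    simp [hw]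
  have h2 := hPQ _ (P.starProjection_apply_mem u)
  have h3 : ‖P.starProjection u‖ ≤ ‖u‖ := P.norm_starProjection_apply_le u
  have h4 : ‖Q.starProjection w‖ ≤ ε * ‖w‖ := by
    have hq := hQP _ (Q.starProjection_apply_mem w)
    set q := Q.starProjection w with hqdef
    have e1 : inner ℝ q w = ‖q‖ * ‖q‖ := by
      have := Q.starProjection_inner_eq_zero w q (Q.starProjection_apply_mem w)
      rw [← hqdef, inner_sub_left, real_inner_self_eq_norm_mul_norm] at this
      rw [real_inner_comm]; linarith
    have e2 : inner ℝ (P.starProjection q) w = 0 := by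
      rw [real_inner_comm]
      exact P.starProjection_inner_eq_zero u _ (P.starProjection_apply_mem q)
    have e3 : inner ℝ (q - P.starProjection q) w = ‖q‖ * ‖q‖ := by
      rw [inner_sub_left, e1, e2, sub_zero]
    have e4 := real_inner_le_norm (q - P.starProjection q) w
    rw [e3] at e4
    rcases (norm_nonneg q).eq_or_lt with h | h
    · rw [← h]; positivity
    · refine le_of_mul_le_mul_left ?_ h
      nlinarith [norm_nonneg w]
  rw [h1]
  refine (norm_sub_le _ _).trans ?_
  nlinarith

theorem norm_starProjection_sub_le_of_ball (P Q : Submodule ℝ E) [P.HasOrthogonalProjection]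
    [Q.HasOrthogonalProjection] {t δ : ℝ} (ht : 0 < t) (hδ : 0 ≤ δ)
    (hPQ : ∀ v ∈ P, ‖v‖ ≤ t → ‖v - Q.starProjection v‖ ≤ δ)
    (hQP : ∀ v ∈ Q, ‖v‖ ≤ t → ‖v - P.starProjection v‖ ≤ δ) :
    ‖P.starProjection - Q.starProjection‖ ≤ 2 * (δ / t) := by
  have key : ∀ P Q : Submodule ℝ E, ∀ [P.HasOrthogonalProjection] [Q.HasOrthogonalProjection],
      (∀ v ∈ P, ‖v‖ ≤ t → ‖v - Q.starProjection v‖ ≤ δ) →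
      ∀ v ∈ P, ‖v - Q.starProjection v‖ ≤ δ / t * ‖v‖ := by
    intro P Q _ _ h v hv
    rcases eq_or_ne v 0 with rfl | hv0
    · simp
    have hn : 0 < ‖v‖ := norm_pos_iff.2 hv0
    have h1 := h ((t / ‖v‖) • v) (P.smul_mem _ hv) (by
      rw [norm_smul, Real.norm_of_nonneg (by positivity), div_mul_cancel₀ _ hn.ne'])
    rw [map_smul, ← smul_sub, norm_smul, Real.norm_of_nonneg (by positivity)] at h1
    rw [div_mul_eq_mul_div, div_le_iff₀ hn] at h1
    rw [div_mul_eq_mul_div, le_div_iff₀ ht]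
    linarith
  exact norm_starProjection_sub_le P Q (by positivity) (key P Q hPQ) (key Q P hQP)

/-- If `v ∈ P` and `Qv = 0`, then `(P - Q)v = v`, which forces `v = 0`; so `Q` is injective on `P`,
and symmetrically. -/
theorem finrank_eq_of_norm_starProjection_sub_lt_one [FiniteDimensional ℝ E]
    {P Q : Submodule ℝ E} (h : ‖P.starProjection - Q.starProjection‖ < 1) :
    Module.finrank ℝ P = Module.finrank ℝ Q := by
  have key : ∀ P Q : Submodule ℝ E, ‖P.starProjection - Q.starProjection‖ < 1 →
      Module.finrank ℝ P ≤ Module.finrank ℝ Q := by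
    intro P Q h
    refine LinearMap.finrank_le_finrank_of_injective
      (f := (Q.orthogonalProjectionOnto : E →ₗ[ℝ] Q) ∘ₗ P.subtype) ?_
    rw [← LinearMap.ker_eq_bot, LinearMap.ker_eq_bot']
    intro v hv
    have hv' : Q.starProjection (v : E) = 0 := by
      rw [Submodule.starProjection_apply]
      simpa using congrArg (Subtype.val) hv
    have h1 : (P.starProjection - Q.starProjection) (v : E) = v := by
      simp [hv', Submodule.starProjection_eq_self_iff.2 v.2]
    have h2 := (P.starProjection - Q.starProjection).le_opNorm (v : E)
    rw [h1] at h2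
    by_contra hne
    have : 0 < ‖(v : E)‖ := norm_pos_iff.2 (by simpa using hne)
    nlinarith
  exact le_antisymm (key P Q h) (key Q P (by rwa [norm_sub_rev]))

theorem exists_eq_starProjection_of_tendsto [FiniteDimensional ℝ E] {P : ℕ → Submodule ℝ E}
    {T : E →L[ℝ] E}
    (h : Filter.Tendsto (fun k => (P k).starProjection) Filter.atTop (nhds T)) :
    ∃ Q : Submodule ℝ E, Q.starProjection = T := by
  have hT : (T : E →ₗ[ℝ] E).IsSymmetricProjection := by
    have ev : ∀ u, Filter.Tendsto (fun k => (P k).starProjection u) Filter.atTop (nhds (T u)) :=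
      fun u => ((ContinuousLinearMap.apply ℝ E u).continuous.tendsto T).comp h
    constructor
    · have h2 : Filter.Tendsto (fun k => (P k).starProjection * (P k).starProjection) Filter.atTop
          (nhds (T * T)) := h.mul h
      have h3 : T * T = T := by
        refine tendsto_nhds_unique (h2.congr fun k => ?_) h
        exact (P k).isIdempotentElem_starProjection
      ext u
      exact congrArg (fun S : E →L[ℝ] E => S u) h3
    · intro u v
      refine tendsto_nhds_unique (((ev u).inner tendsto_const_nhds).congr fun k => ?_)
        (tendsto_const_nhds.inner (ev v))
      exact (P k).inner_starProjection_left_eq_right u v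
  obtain ⟨Q, _, hQ⟩ := LinearMap.isSymmetricProjection_iff_eq_coe_starProjection.1 hT
  refine ⟨Q, ?_⟩
  ext u
  exact congrArg (fun S : E →ₗ[ℝ] E => S u) hQ.symm

/-- A subspace close to `P` is the graph of a linear map from `P` to its orthogonal complement. -/
theorem exists_graph_linearMap [FiniteDimensional ℝ E] (P Q : Submodule ℝ E)
    (h : ‖P.starProjection - Q.starProjection‖ ≤ 1 / 16) :
    ∃ L : P →L[ℝ] Pᗮ, ‖L‖ ≤ 1 ∧ (∀ u : P, (u : E) + L u ∈ Q) ∧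
      ∀ v : E, ‖Pᗮ.orthogonalProjectionOnto v - L (P.orthogonalProjectionOnto v)‖ ≤
        2 * ‖v - Q.starProjection v‖ := by
  have hQ : ∀ q ∈ Q, ‖q - P.starProjection q‖ ≤ 1 / 16 * ‖q‖ := by
    intro q hq
    have h1 := (P.starProjection - Q.starProjection).le_opNorm q
    rw [sub_apply, Submodule.starProjection_eq_self_iff.2 hq,
      norm_sub_rev] at h1
    exact h1.trans (by gcongr)
  have hfin := finrank_eq_of_norm_starProjection_sub_lt_one (h.trans_lt (by norm_num))
  let g : Q →ₗ[ℝ] P := (P.orthogonalProjectionOnto : E →ₗ[ℝ] P) ∘ₗ Q.subtype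
  have hg : ∀ q : Q, (g q : E) = P.starProjection q := fun q => by
    rw [Submodule.starProjection_apply]; rfl
  have hginj : Function.Injective g := by
    rw [← LinearMap.ker_eq_bot, LinearMap.ker_eq_bot']
    intro q hq
    have h1 := hQ q q.2
    rw [← hg, hq, ZeroMemClass.coe_zero, sub_zero] at h1
    have : ‖(q : E)‖ = 0 := by linarith [norm_nonneg (q : E)]
    simpa using this
  let e : Q ≃ₗ[ℝ] P := LinearMap.linearEquivOfInjective g hginj hfin.symm
  have he : ∀ q, e q = g q := fun q => rfl
  let L₀ : P →ₗ[ℝ] Pᗮ :=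
    ((Pᗮ.orthogonalProjectionOnto : E →ₗ[ℝ] Pᗮ) ∘ₗ Q.subtype) ∘ₗ (e.symm : P →ₗ[ℝ] Q)
  have hL₀ : ∀ u : P, (L₀ u : E) = (e.symm u : E) - P.starProjection (e.symm u : E) := fun u => by
    rw [← Submodule.starProjection_orthogonal_val, Submodule.starProjection_apply]; rfl
  have hsum : ∀ u : P, (u : E) + L₀ u = e.symm u := fun u => by
    have : (u : E) = P.starProjection (e.symm u : E) := by
      rw [← hg, ← he, LinearEquiv.apply_symm_apply]
    rw [hL₀, ← this]; abel
  have hbound : ∀ u : P, ‖L₀ u‖ ≤ 1 * ‖u‖ := fun u => by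
    have h1 := hQ (e.symm u) (e.symm u).2
    rw [← hL₀, ← hsum] at h1
    have h2 := norm_add_le (u : E) (L₀ u)
    simp only [Submodule.coe_norm] at *
    linarith [norm_nonneg (u : E)]
  refine ⟨L₀.mkContinuous 1 hbound, LinearMap.mkContinuous_norm_le _ zero_le_one _, ?_, ?_⟩
  · intro u
    simp only [LinearMap.mkContinuous_apply, hsum]
    exact (e.symm u).2
  · intro v
    simp only [LinearMap.mkContinuous_apply]
    set q : Q := Q.orthogonalProjectionOnto v
    have hq : (q : E) = Q.starProjection v := (Submodule.starProjection_apply _ _).symm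
    -- The map `v ↦ π_{P^⊥} v - L π_P v` vanishes on `Q`, so `v` may be replaced by `v - Qv`; since
    -- `‖L‖ ≤ 1`, its two terms give the factor 2.
    have h0 : Pᗮ.orthogonalProjectionOnto (q : E) = L₀ (P.orthogonalProjectionOnto (q : E)) := by
      have : P.orthogonalProjectionOnto (q : E) = e q := rfl
      rw [this]
      simp [L₀]
    have h1 : Pᗮ.orthogonalProjectionOnto v - L₀ (P.orthogonalProjectionOnto v) =
        Pᗮ.orthogonalProjectionOnto (v - q) - L₀ (P.orthogonalProjectionOnto (v - q)) := by
      rw [map_sub, map_sub, map_sub, h0]; abel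
    rw [h1, ← hq]
    refine (norm_sub_le _ _).trans ?_
    have h2 : ‖Pᗮ.orthogonalProjectionOnto (v - q)‖ ≤ ‖v - q‖ := by
      simpa using Pᗮ.norm_orthogonalProjectionOnto_apply_le (v - q)
    have h3 := P.norm_orthogonalProjectionOnto_apply_le (v - q)
    have h4 := hbound (P.orthogonalProjectionOnto (v - q))
    linarith

end Projections

/-! ### From flat approximations to Hölder continuous tangent planes -/

section TangentPlanes

variable {E : Type*} [NormedAddCommGroup E] [InnerProductSpace ℝ E] [FiniteDimensional ℝ E]

/-- At every point and every scale `r ≤ r₀`, the set `S` is bilaterally close to some `m`-plane, up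
to the error `C r ^ (1 + κ)`. -/
def HasFlatApprox (m : ℕ) (κ C r₀ : ℝ) (S : Set E) : Prop :=
  ∀ x ∈ S, ∀ r : ℝ, 0 < r → r ≤ r₀ → ∃ P : Submodule ℝ E, Module.finrank ℝ P = m ∧
    (∀ y ∈ S, ‖y - x‖ ≤ r → ‖(y - x) - P.starProjection (y - x)‖ ≤ C * r ^ κ * r) ∧
    ∀ v ∈ P, ‖v‖ ≤ r → ∃ y ∈ S, ‖x + v - y‖ ≤ C * r ^ κ * r

/-- The planes `H x` are tangent to `S` at all points `x`, with error `C r ^ (1 + κ)`, and they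
depend on `x` in a Hölder continuous way. -/
structure HasTangentPlanes (m : ℕ) (κ C r₁ : ℝ) (S : Set E) (H : E → Submodule ℝ E) : Prop where
  finrank_eq : ∀ x ∈ S, Module.finrank ℝ (H x) = m
  near : ∀ x ∈ S, ∀ y ∈ S, ‖y - x‖ ≤ r₁ →
    ‖(y - x) - (H x).starProjection (y - x)‖ ≤ C * ‖y - x‖ ^ κ * ‖y - x‖
  fill : ∀ x ∈ S, ∀ v ∈ H x, ‖v‖ ≤ r₁ → ∃ y ∈ S, ‖x + v - y‖ ≤ C * ‖v‖ ^ κ * ‖v‖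
  osc : ∀ x ∈ S, ∀ y ∈ S, ‖x - y‖ ≤ r₁ →
    ‖(H x).starProjection - (H y).starProjection‖ ≤ C * ‖x - y‖ ^ κ

/-- Write `v = (x + v - z) + (z - y) - (x - y)` with `z ∈ S` close to `x + v`: the first term has
length at most `δ`, the other two lie within `δ'` of `Q`. It serves to compare planes at one point
and two scales, and at two points and one scale. -/
theorem norm_sub_starProjection_le_of_fill_of_near {S : Set E} {P Q : Submodule ℝ E} {x y : E}
    {t s δ δ' : ℝ} (hx : x ∈ S) (ht : 0 ≤ t) (hδ : 0 ≤ δ)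
    (fill : ∀ v ∈ P, ‖v‖ ≤ t → ∃ z ∈ S, ‖x + v - z‖ ≤ δ)
    (near : ∀ z ∈ S, ‖z - y‖ ≤ s → ‖(z - y) - Q.starProjection (z - y)‖ ≤ δ')
    (hs : ‖x - y‖ + t + δ ≤ s) :
    ∀ v ∈ P, ‖v‖ ≤ t → ‖v - Q.starProjection v‖ ≤ δ + 2 * δ' := by
  intro v hv hvt
  obtain ⟨z, hz, hzv⟩ := fill v hv hvt
  have h1 : ‖z - y‖ ≤ s := by
    have : z - y = (x - y) + v - (x + v - z) := by abel
    rw [this]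
    linarith [norm_sub_le ((x - y) + v) (x + v - z), norm_add_le (x - y) v]
  have h2 := near z hz h1
  have h3 := near x hx (by linarith)
  have h4 := norm_sub_starProjection_le Q (x + v - z)
  have h5 : v = (x + v - z) + ((z - y) + -(x - y)) := by abel
  have h6 := norm_sub_starProjection_add_le Q (x + v - z) ((z - y) + -(x - y))
  have h7 := norm_sub_starProjection_add_le Q (z - y) (-(x - y))
  rw [← h5] at h6
  have h8 : ‖-(x - y) - Q.starProjection (-(x - y))‖ = ‖(x - y) - Q.starProjection (x - y)‖ := by
    rw [map_neg, ← neg_sub', norm_neg]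
  linarith

theorem exists_pos_le_mul_rpow_le {κ : ℝ} (hκ : 0 < κ) {C : ℝ} (hC : 0 ≤ C) {r₀ ε : ℝ}
    (hr₀ : 0 < r₀) (hε : 0 < ε) : ∃ r, 0 < r ∧ r ≤ r₀ ∧ C * r ^ κ ≤ ε := by
  have hq : 0 < ε / (C + 1) := by positivity
  refine ⟨min r₀ ((ε / (C + 1)) ^ κ⁻¹), lt_min hr₀ (by positivity), min_le_left _ _, ?_⟩
  have h1 : (min r₀ ((ε / (C + 1)) ^ κ⁻¹)) ^ κ ≤ ε / (C + 1) := by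
    calc _ ≤ ((ε / (C + 1)) ^ κ⁻¹) ^ κ :=
          Real.rpow_le_rpow (by positivity) (min_le_right _ _) hκ.le
      _ = ε / (C + 1) := Real.rpow_inv_rpow hq.le hκ.ne'
  calc C * _ ≤ C * (ε / (C + 1)) := by gcongr
    _ ≤ (C + 1) * (ε / (C + 1)) := by gcongr; linarith
    _ = ε := by field_simp

theorem rpow_le_mul_rpow {κ : ℝ} (hκ : 0 ≤ κ) (hκ1 : κ ≤ 1) {a b c : ℝ} (ha : 0 ≤ a) (hb : 0 ≤ b)
    (hc : 1 ≤ c) (h : a ≤ c * b) : a ^ κ ≤ c * b ^ κ := by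
  calc a ^ κ ≤ (c * b) ^ κ := Real.rpow_le_rpow ha h hκ
    _ = c ^ κ * b ^ κ := Real.mul_rpow (by linarith) hb
    _ ≤ c * b ^ κ := by
      gcongr
      simpa using Real.rpow_le_rpow_of_exponent_le hc hκ1

/-- Consecutive dyadic planes describe the same piece of `S`, so their distance is at most a
geometric term of ratio `(1/2)^κ`. The limit of the projections is again a projection. -/
theorem exists_limit_plane {κ : ℝ} (hκ : 0 < κ) {m : ℕ} {C r₁ : ℝ} (hC : 0 ≤ C)
    (hr₁ : 0 < r₁) (hCr : C * r₁ ^ κ ≤ 1 / 4) {S : Set E} {x : E} (hx : x ∈ S)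
    {P : ℕ → Submodule ℝ E} (hm : ∀ k, Module.finrank ℝ (P k) = m)
    (near : ∀ k, ∀ y ∈ S, ‖y - x‖ ≤ r₁ * (1 / 2) ^ k →
      ‖(y - x) - (P k).starProjection (y - x)‖ ≤
        C * (r₁ * (1 / 2) ^ k) ^ κ * (r₁ * (1 / 2) ^ k))
    (fill : ∀ k, ∀ v ∈ P k, ‖v‖ ≤ r₁ * (1 / 2) ^ k →
      ∃ y ∈ S, ‖x + v - y‖ ≤ C * (r₁ * (1 / 2) ^ k) ^ κ * (r₁ * (1 / 2) ^ k)) :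
    ∃ Q : Submodule ℝ E, Module.finrank ℝ Q = m ∧
      ∀ k, ‖(P k).starProjection - Q.starProjection‖ ≤
        24 * C / (1 - (1 / 2) ^ κ) * (r₁ * (1 / 2) ^ k) ^ κ := by
  set q : ℝ := (1 / 2 : ℝ) ^ κ with hq
  have hq1 : q < 1 := Real.rpow_lt_one (by norm_num) (by norm_num) hκ
  have hpow : ∀ k : ℕ, (r₁ * (1 / 2) ^ k) ^ κ = r₁ ^ κ * q ^ k := fun k => by
    rw [Real.mul_rpow hr₁.le (by positivity), hq, ← Real.rpow_natCast, ← Real.rpow_natCast,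
      ← Real.rpow_mul (by norm_num), ← Real.rpow_mul (by norm_num), mul_comm κ]
  have hstep : ∀ k, dist (P k).starProjection (P (k + 1)).starProjection ≤
      24 * C * r₁ ^ κ * q ^ k := by
    intro k
    have hpos : 0 < r₁ * (1 / 2) ^ k := by positivity
    have hle : r₁ * (1 / 2) ^ (k + 1) = r₁ * (1 / 2) ^ k / 2 := by rw [pow_succ]; ring
    have nearS := near (k + 1)
    have fillS := fill (k + 1)
    have nearK := near k
    have fillK := fill k
    rw [hle] at nearS fillS
    set r := r₁ * (1 / 2) ^ k with hr
    have hrr : r ≤ r₁ := mul_le_of_le_one_right hr₁.le (pow_le_one₀ (by norm_num) (by norm_num))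
    have hCr' : C * r ^ κ ≤ 1 / 4 := le_trans (by gcongr) hCr
    have hδ : C * (r / 2) ^ κ * (r / 2) ≤ C * r ^ κ * r := by
      have : (r / 2) ^ κ ≤ r ^ κ := Real.rpow_le_rpow (by positivity) (by linarith) hκ.le
      gcongr
      linarith
    have hδ0 : 0 ≤ C * r ^ κ * r := by positivity
    have hδ4 : C * r ^ κ * r ≤ r / 4 := by nlinarith
    -- Radius `r/4` plus an error of at most `r/4` stays in the smaller ball `r/2`. On radius `r/4`
    -- the planes differ by `3Cr^κ·r`, whence `2·3·4 = 24`.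
    have h1 := norm_sub_starProjection_le_of_fill_of_near (S := S) (P := P k) (Q := P (k + 1))
      (x := x) (y := x) (t := r / 4) (s := r / 2) hx (by positivity) hδ0
      (fun v hv hvt => fillK v hv (by linarith))
      (fun z hz hzs => (nearS z hz hzs).trans hδ) (by simp; linarith)
    have h2 := norm_sub_starProjection_le_of_fill_of_near (S := S) (P := P (k + 1)) (Q := P k)
      (x := x) (y := x) (t := r / 4) (s := r) hx (by positivity) hδ0
      (fun v hv hvt => by
        obtain ⟨y, hy, hy'⟩ := fillS v hv (by linarith)
        exact ⟨y, hy, hy'.trans hδ⟩)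
      nearK (by simp; linarith)
    have h3 := norm_starProjection_sub_le_of_ball (P k) (P (k + 1)) (by positivity)
      (by positivity) h1 h2
    rw [dist_eq_norm]
    refine h3.trans (le_of_eq ?_)
    rw [mul_assoc (24 * C), ← hpow k, ← hr]
    field_simp
    ring
  obtain ⟨T, hT⟩ := cauchySeq_tendsto_of_complete (cauchySeq_of_le_geometric q _ hq1 hstep)
  obtain ⟨Q, rfl⟩ := exists_eq_starProjection_of_tendsto hT
  refine ⟨Q, ?_, fun k => ?_⟩
  · obtain ⟨k, hk⟩ := ((Metric.tendsto_nhds.1 hT) 1 one_pos).exists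
    rw [dist_eq_norm] at hk
    rw [← finrank_eq_of_norm_starProjection_sub_lt_one hk, hm k]
  · have := dist_le_of_le_geometric_of_tendsto q _ hq1 hstep hT k
    rw [dist_eq_norm] at this
    refine this.trans (le_of_eq ?_)
    rw [hpow]; ring

theorem exists_dyadic {r₁ r : ℝ} (hr₁ : 0 < r₁) (hr : 0 < r) (h : r ≤ r₁) :
    ∃ k : ℕ, r ≤ r₁ * (1 / 2) ^ k ∧ r₁ * (1 / 2) ^ k ≤ 2 * r := by
  obtain ⟨k, h1, h2⟩ := exists_nat_pow_near_of_lt_one (x := r / r₁) (y := (1 / 2 : ℝ))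
    (by positivity) ((div_le_one hr₁).2 h) (by norm_num) (by norm_num)
  rw [lt_div_iff₀ hr₁, pow_succ] at h1
  rw [div_le_iff₀ hr₁] at h2
  exact ⟨k, by linarith, by linarith⟩

/-- At a point of a set with flat approximations there is a tangent plane. -/
theorem exists_tangent_plane {κ : ℝ} (hκ : 0 < κ) (hκ1 : κ ≤ 1) {m : ℕ} {C r₁ : ℝ} (hC : 0 ≤ C)
    (hr₁ : 0 < r₁) (hCr : C * r₁ ^ κ ≤ 1 / 4) {S : Set E} (hS : HasFlatApprox m κ C r₁ S)
    {x : E} (hx : x ∈ S) :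
    ∃ Q : Submodule ℝ E, Module.finrank ℝ Q = m ∧
      (∀ y ∈ S, ‖y - x‖ ≤ r₁ → ‖(y - x) - Q.starProjection (y - x)‖ ≤
        (4 * C + 2 * (24 * C / (1 - (1 / 2) ^ κ))) * ‖y - x‖ ^ κ * ‖y - x‖) ∧
      ∀ v ∈ Q, ‖v‖ ≤ r₁ → ∃ y ∈ S, ‖x + v - y‖ ≤
        (4 * C + 2 * (24 * C / (1 - (1 / 2) ^ κ))) * ‖v‖ ^ κ * ‖v‖ := by
  have hle : ∀ k : ℕ, r₁ * (1 / 2) ^ k ≤ r₁ := fun k =>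
    mul_le_of_le_one_right hr₁.le (pow_le_one₀ (by norm_num) (by norm_num))
  choose P hm near fill using fun k : ℕ => hS x hx (r₁ * (1 / 2) ^ k) (by positivity) (hle k)
  obtain ⟨Q, hQm, hQ⟩ := exists_limit_plane hκ hC hr₁ hCr hx hm near fill
  set B := 24 * C / (1 - (1 / 2 : ℝ) ^ κ) with hB
  have hB0 : 0 ≤ B :=
    div_nonneg (by positivity) (sub_nonneg.2 (Real.rpow_le_one (by norm_num) (by norm_num) hκ.le))
  refine ⟨Q, hQm, ?_, ?_⟩
  · intro y hy hyx
    rcases (norm_nonneg (y - x)).eq_or_lt with h0 | h0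
    · rw [norm_sub_eq_zero_iff.1 h0.symm]; simp
    obtain ⟨k, hk1, hk2⟩ := exists_dyadic hr₁ h0 hyx
    have h1 := near k y hy hk1
    have h2 := ((P k).starProjection - Q.starProjection).le_of_opNorm_le (hQ k) (y - x)
    set ρ := r₁ * (1 / 2 : ℝ) ^ k
    set r := ‖y - x‖ with hr
    have hρ0 : 0 ≤ ρ := by positivity
    have hρ : ρ ^ κ ≤ 2 * r ^ κ := rpow_le_mul_rpow hκ.le hκ1 hρ0 h0.le (by norm_num) hk2
    have h3 : (y - x) - Q.starProjection (y - x) = ((y - x) - (P k).starProjection (y - x)) +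
        ((P k).starProjection - Q.starProjection) (y - x) := by
      rw [sub_apply]; abel
    rw [h3]
    calc _ ≤ C * ρ ^ κ * ρ + B * ρ ^ κ * r := (norm_add_le _ _).trans (add_le_add h1 h2)
      _ ≤ C * (2 * r ^ κ) * (2 * r) + B * (2 * r ^ κ) * r := by gcongr
      _ = _ := by ring
  · intro v hv hvr
    rcases (norm_nonneg v).eq_or_lt with h0 | h0
    · refine ⟨x, hx, ?_⟩
      rw [norm_eq_zero.1 h0.symm]; simp
    obtain ⟨k, hk1, hk2⟩ := exists_dyadic hr₁ h0 hvr
    -- The vector `v` lies in the limit plane, not in `P k`; its projection is filled instead, and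
    -- the drift of the planes is added to the error.
    obtain ⟨y, hy, h1⟩ := fill k ((P k).starProjection v) ((P k).starProjection_apply_mem v)
      (((P k).norm_starProjection_apply_le v).trans hk1)
    have h2 := ((P k).starProjection - Q.starProjection).le_of_opNorm_le (hQ k) v
    rw [sub_apply, Submodule.starProjection_eq_self_iff.2 hv] at h2
    refine ⟨y, hy, ?_⟩
    set ρ := r₁ * (1 / 2 : ℝ) ^ k
    set r := ‖v‖ with hr
    have hρ0 : 0 ≤ ρ := by positivity
    have hρ : ρ ^ κ ≤ 2 * r ^ κ := rpow_le_mul_rpow hκ.le hκ1 hρ0 h0.le (by norm_num) hk2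
    have h3 : x + v - y = (x + (P k).starProjection v - y) - ((P k).starProjection v - v) := by
      abel
    rw [h3]
    calc _ ≤ C * ρ ^ κ * ρ + B * ρ ^ κ * r := (norm_sub_le _ _).trans (add_le_add h1 h2)
      _ ≤ C * (2 * r ^ κ) * (2 * r) + B * (2 * r ^ κ) * r := by gcongr
      _ = _ := by ring

theorem exists_hasTangentPlanes {κ : ℝ} (hκ : 0 < κ) (hκ1 : κ ≤ 1) {C r₀ : ℝ} (hC : 0 ≤ C)
    (hr₀ : 0 < r₀) :
    ∃ C' r₁ : ℝ, 0 ≤ C' ∧ 0 < r₁ ∧ C' * r₁ ^ κ ≤ 1 / 16 ∧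
      ∀ (m : ℕ) (S : Set E), HasFlatApprox m κ C r₀ S → ∃ H, HasTangentPlanes m κ C' r₁ S H := by
  obtain ⟨r₁, hr₁, hr₁₀, hCr⟩ := exists_pos_le_mul_rpow_le hκ hC hr₀ (ε := 1 / 4) (by norm_num)
  set B := 4 * C + 2 * (24 * C / (1 - (1 / 2 : ℝ) ^ κ)) with hB
  have hB0 : 0 ≤ B := by
    have : 0 ≤ 24 * C / (1 - (1 / 2 : ℝ) ^ κ) := div_nonneg (by positivity)
      (sub_nonneg.2 (Real.rpow_le_one (by norm_num) (by norm_num) hκ.le))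
    positivity
  -- For points at distance `r`, the comparison takes place in a ball of radius `3r ≤ r₁`, where the
  -- tangency error is at most `B·3r^κ·3r`. So the planes differ by `(1 + 2·9)Br^κ·r` on radius `r`,
  -- and passing to the operator norm doubles 19 to 38.
  obtain ⟨r₂, hr₂, hr₂₁, hBr⟩ := exists_pos_le_mul_rpow_le hκ (C := 38 * B) (by positivity)
    (r₀ := r₁ / 3) (ε := 1 / 16) (by positivity) (by norm_num)
  refine ⟨38 * B, r₂, by positivity, hr₂, hBr, fun m S hS => ?_⟩
  have hS' : HasFlatApprox m κ C r₁ S := fun x hx r h0 h1 => hS x hx r h0 (h1.trans hr₁₀)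
  have hex : ∀ x, ∃ Q : Submodule ℝ E, x ∈ S → Module.finrank ℝ Q = m ∧
      (∀ y ∈ S, ‖y - x‖ ≤ r₁ → ‖(y - x) - Q.starProjection (y - x)‖ ≤
        B * ‖y - x‖ ^ κ * ‖y - x‖) ∧
      ∀ v ∈ Q, ‖v‖ ≤ r₁ → ∃ y ∈ S, ‖x + v - y‖ ≤ B * ‖v‖ ^ κ * ‖v‖ := by
    intro x
    by_cases hx : x ∈ S
    · obtain ⟨Q, hQ⟩ := exists_tangent_plane hκ hκ1 hC hr₁ hCr hS' hx
      exact ⟨Q, fun _ => hQ⟩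
    · exact ⟨⊥, fun h => absurd h hx⟩
  choose H hH using hex
  refine ⟨H, fun x hx => (hH x hx).1, ?_, ?_, ?_⟩
  · intro x hx y hy hyx
    refine ((hH x hx).2.1 y hy (by linarith)).trans ?_
    gcongr
    linarith
  · intro x hx v hv hvr
    obtain ⟨y, hy, h⟩ := (hH x hx).2.2 v hv (by linarith)
    refine ⟨y, hy, h.trans ?_⟩
    gcongr
    linarith
  · intro x hx y hy hxy
    rcases (norm_nonneg (x - y)).eq_or_lt with h0 | h0
    · rw [norm_sub_eq_zero_iff.1 h0.symm]
      simp only [sub_self, norm_zero]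
      positivity
    set r := ‖x - y‖ with hr
    have hrκ : B * r ^ κ ≤ 1 := by
      have : r ^ κ ≤ r₂ ^ κ := Real.rpow_le_rpow h0.le hxy hκ.le
      nlinarith [Real.rpow_nonneg h0.le κ, mul_le_mul_of_nonneg_left this hB0]
    have key : ∀ x ∈ S, ∀ y ∈ S, ‖x - y‖ = r → ∀ v ∈ H x, ‖v‖ ≤ r →
        ‖v - (H y).starProjection v‖ ≤ B * r ^ κ * r + 2 * (9 * B * r ^ κ * r) := by
      intro x hx y hy hxy'
      refine norm_sub_starProjection_le_of_fill_of_near (S := S) (x := x) (y := y) (s := 3 * r)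
        hx h0.le (by positivity) (fun v hv hvr => ?_) (fun z hz hzy => ?_) ?_
      · obtain ⟨z, hz, h⟩ := (hH x hx).2.2 v hv (by linarith)
        refine ⟨z, hz, h.trans ?_⟩
        gcongr
      · refine ((hH y hy).2.1 z hz (by linarith)).trans ?_
        have : ‖z - y‖ ^ κ ≤ 3 * r ^ κ :=
          rpow_le_mul_rpow hκ.le hκ1 (norm_nonneg _) h0.le (by norm_num) hzy
        calc _ ≤ B * (3 * r ^ κ) * (3 * r) := by gcongr
          _ = _ := by ring
      · rw [hxy']
        nlinarith
    have h1 := norm_starProjection_sub_le_of_ball (H x) (H y) h0 (by positivity)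
      (key x hx y hy rfl) (key y hy x hx (by rw [norm_sub_rev]))
    refine h1.trans (le_of_eq ?_)
    field_simp
    ring

end TangentPlanes

/-! ### Hölder bounds and global extension of `C^{1,κ}` functions -/

theorem holderOnWith_of_dist_le {X Y : Type*} [PseudoMetricSpace X] [PseudoMetricSpace Y]
    {f : X → Y} {s : Set X} {C : ℝ} {κ : ℝ≥0}
    (h : ∀ x ∈ s, ∀ y ∈ s, dist (f x) (f y) ≤ C * dist x y ^ (κ : ℝ)) :
    HolderOnWith C.toNNReal κ f s := by
  intro x hx y hy
  rw [edist_dist, edist_dist, ENNReal.ofReal_rpow_of_nonneg dist_nonneg κ.coe_nonneg]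
  calc ENNReal.ofReal (dist (f x) (f y)) ≤ ENNReal.ofReal (C * dist x y ^ (κ : ℝ)) :=
        ENNReal.ofReal_le_ofReal (h x hx y hy)
    _ = _ := by
      rw [mul_comm, ENNReal.ofReal_mul (by positivity), mul_comm]
      rfl

/-- A function with Hölder continuous derivative on a ball coincides on the concentric ball of half
the radius with a globally defined function of class `C^{1,κ}`. -/
theorem exists_c1Holder_extension {V W : Type*} [NormedAddCommGroup V] [InnerProductSpace ℝ V]
    [FiniteDimensional ℝ V] [NormedAddCommGroup W] [NormedSpace ℝ W] {κ : ℝ≥0} (hκ : 0 < κ)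
    (hκ1 : κ ≤ 1) {f : V → W} {D : V → V →L[ℝ] W} {ρ K : ℝ} (hρ : 0 < ρ) (hK : 0 ≤ K)
    (hf : ∀ ξ ∈ ball (0 : V) ρ, HasFDerivAt f (D ξ) ξ)
    (hD : ∀ ξ ∈ ball (0 : V) ρ, ∀ ζ ∈ ball (0 : V) ρ, ‖D ξ - D ζ‖ ≤ K * ‖ξ - ζ‖ ^ (κ : ℝ)) :
    ∃ g : V → W, IsC1HolderOn κ g univ ∧ EqOn g f (ball 0 (ρ / 2)) := by
  let χ : ContDiffBump (0 : V) := ⟨ρ / 2, 3 * ρ / 4, by positivity, by linarith⟩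
  -- The cutoff acts on the argument: `Φ` maps everything into the ball where `f` is controlled and
  -- is the identity on the half ball, so the chain rule yields the Hölder bound.
  let Φ : V → V := fun ξ => χ ξ • ξ
  have hΦs : ContDiff ℝ 2 Φ := χ.contDiff.smul contDiff_id
  have hΦc : HasCompactSupport Φ := χ.hasCompactSupport.smul_right
  have hΦball : ∀ ξ, Φ ξ ∈ ball (0 : V) ρ := by
    intro ξ
    rw [mem_ball_zero_iff]
    by_cases hξ : ‖ξ‖ < 3 * ρ / 4
    · have : ‖Φ ξ‖ = χ ξ * ‖ξ‖ := by
        simp only [Φ, norm_smul, Real.norm_of_nonneg χ.nonneg]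
      rw [this]
      nlinarith [χ.le_one (x := ξ), χ.nonneg (x := ξ), norm_nonneg ξ]
    · have : χ ξ = 0 := χ.zero_of_le_dist (by simpa using not_lt.1 hξ)
      simpa [Φ, this] using hρ
  obtain ⟨C₁, hC₁⟩ := hΦs.lipschitzWith_of_hasCompactSupport hΦc (by norm_num)
  obtain ⟨C₂, hC₂⟩ := (hΦs.fderiv_right (m := 1) (by norm_num)).lipschitzWith_of_hasCompactSupport
    (hΦc.fderiv (𝕜 := ℝ)) (by norm_num)
  have hA : ∀ ξ, ‖fderiv ℝ Φ ξ‖ ≤ C₁ := fun ξ => norm_fderiv_le_of_lipschitz ℝ hC₁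
  have hAκ : ∀ ξ ζ, ‖fderiv ℝ Φ ξ - fderiv ℝ Φ ζ‖ ≤ (C₂ + 2 * C₁) * ‖ξ - ζ‖ ^ (κ : ℝ) := by
    intro ξ ζ
    rcases le_total ‖ξ - ζ‖ 1 with h | h
    · have h1 : ‖fderiv ℝ Φ ξ - fderiv ℝ Φ ζ‖ ≤ C₂ * ‖ξ - ζ‖ := hC₂.norm_sub_le ξ ζ
      have h2 : ‖ξ - ζ‖ ≤ ‖ξ - ζ‖ ^ (κ : ℝ) := by
        simpa using Real.rpow_le_rpow_of_exponent_ge' (norm_nonneg _) h κ.coe_nonneg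
          (NNReal.coe_le_one.2 hκ1)
      calc _ ≤ C₂ * ‖ξ - ζ‖ := h1
        _ ≤ (C₂ + 2 * C₁) * ‖ξ - ζ‖ ^ (κ : ℝ) := by
          gcongr
          linarith [C₁.coe_nonneg]
    · have h1 := norm_sub_le (fderiv ℝ Φ ξ) (fderiv ℝ Φ ζ)
      have h2 : 1 ≤ ‖ξ - ζ‖ ^ (κ : ℝ) := Real.one_le_rpow h κ.coe_nonneg
      have := hA ξ
      have := hA ζ
      nlinarith [C₁.coe_nonneg, C₂.coe_nonneg]
  have hDb : ∀ ξ ∈ ball (0 : V) ρ, ‖D ξ‖ ≤ ‖D 0‖ + K * ρ ^ (κ : ℝ) := by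
    intro ξ hξ
    have h1 := hD ξ hξ 0 (mem_ball_self hρ)
    have h2 := norm_le_norm_add_norm_sub' (D ξ) (D 0)
    have h3 : ‖ξ - 0‖ ^ (κ : ℝ) ≤ ρ ^ (κ : ℝ) :=
      Real.rpow_le_rpow (norm_nonneg _) (by simpa using (mem_ball_zero_iff.1 hξ).le) κ.coe_nonneg
    have := mul_le_mul_of_nonneg_left h3 hK
    linarith
  have hg : ∀ ξ, HasFDerivAt (f ∘ Φ) ((D (Φ ξ)).comp (fderiv ℝ Φ ξ)) ξ := fun ξ =>
    (hf _ (hΦball ξ)).comp ξ (hΦs.differentiable (by norm_num) ξ).hasFDerivAt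
  have hfd : fderiv ℝ (f ∘ Φ) = fun ξ => (D (Φ ξ)).comp (fderiv ℝ Φ ξ) :=
    funext fun ξ => (hg ξ).fderiv
  set B := ‖D 0‖ + K * ρ ^ (κ : ℝ) with hB
  have hB0 : 0 ≤ B := by positivity
  have hhol : ∀ ξ ζ, ‖fderiv ℝ (f ∘ Φ) ξ - fderiv ℝ (f ∘ Φ) ζ‖ ≤
      (K * (C₁ : ℝ) ^ (κ : ℝ) * C₁ + B * (C₂ + 2 * C₁)) * ‖ξ - ζ‖ ^ (κ : ℝ) := by
    intro ξ ζ
    have e : fderiv ℝ (f ∘ Φ) ξ - fderiv ℝ (f ∘ Φ) ζ =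
        (D (Φ ξ) - D (Φ ζ)).comp (fderiv ℝ Φ ξ) +
          (D (Φ ζ)).comp (fderiv ℝ Φ ξ - fderiv ℝ Φ ζ) := by
      rw [hfd]
      ext v
      simp
    have h1 : ‖D (Φ ξ) - D (Φ ζ)‖ ≤ K * ((C₁ : ℝ) ^ (κ : ℝ) * ‖ξ - ζ‖ ^ (κ : ℝ)) := by
      refine (hD _ (hΦball ξ) _ (hΦball ζ)).trans ?_
      rw [← Real.mul_rpow C₁.coe_nonneg (norm_nonneg _)]
      have := hC₁.norm_sub_le ξ ζ
      gcongr
    rw [e]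
    calc _ ≤ ‖D (Φ ξ) - D (Φ ζ)‖ * ‖fderiv ℝ Φ ξ‖ +
          ‖D (Φ ζ)‖ * ‖fderiv ℝ Φ ξ - fderiv ℝ Φ ζ‖ :=
          (norm_add_le _ _).trans (add_le_add (ContinuousLinearMap.opNorm_comp_le _ _)
            (ContinuousLinearMap.opNorm_comp_le _ _))
      _ ≤ K * ((C₁ : ℝ) ^ (κ : ℝ) * ‖ξ - ζ‖ ^ (κ : ℝ)) * C₁ +
          B * ((C₂ + 2 * C₁) * ‖ξ - ζ‖ ^ (κ : ℝ)) := by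
          gcongr
          · exact hA ξ
          · exact hDb _ (hΦball ζ)
          · exact hAκ ξ ζ
      _ = _ := by ring
  have hholder := holderOnWith_of_dist_le (s := univ) (f := fderiv ℝ (f ∘ Φ)) (κ := κ)
    (fun ξ _ ζ _ => by simpa only [dist_eq_norm] using hhol ξ ζ)
  refine ⟨f ∘ Φ, ⟨?_, _, hholder⟩, ?_⟩
  · rw [contDiffOn_univ, contDiff_one_iff_fderiv]
    exact ⟨fun ξ => (hg ξ).differentiableAt, (holderOnWith_univ.1 hholder).continuous hκ⟩
  · intro ξ hξ
    have : χ ξ = 1 := χ.one_of_mem_closedBall (ball_subset_closedBall hξ)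
    simp [Φ, this]

/-! ### Local graphs over tangent planes -/

section LocalGraph

variable {E : Type*} [NormedAddCommGroup E] [InnerProductSpace ℝ E] [FiniteDimensional ℝ E]
  {m : ℕ} {κ C r₁ : ℝ} {S : Set E} {H : E → Submodule ℝ E}

theorem mul_rpow_le_of_le (hκ : 0 < κ) (hC : 0 ≤ C) (hCr : C * r₁ ^ κ ≤ 1 / 16) {t : ℝ}
    (ht : 0 ≤ t) (htr : t ≤ r₁) : C * t ^ κ ≤ 1 / 16 :=
  le_trans (mul_le_mul_of_nonneg_left (Real.rpow_le_rpow ht htr hκ.le) hC) hCr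

/-- Tangency at `y` and the oscillation between `H x` and `H y` each cost `‖z - y‖/16`, leaving
`7/8`. This makes the projection to `H x` injective near `x`, with Lipschitz inverse. -/
theorem HasTangentPlanes.norm_sub_le_projection (hT : HasTangentPlanes m κ C r₁ S H) (hκ : 0 < κ)
    (hC : 0 ≤ C) (hCr : C * r₁ ^ κ ≤ 1 / 16) {x y z : E} (hx : x ∈ S) (hy : y ∈ S) (hz : z ∈ S)
    (hyx : ‖y - x‖ ≤ r₁ / 2) (hzx : ‖z - x‖ ≤ r₁ / 2) :
    ‖z - y‖ ≤ 8 / 7 * ‖(H x).starProjection (z - y)‖ := by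
  have hzy : ‖z - y‖ ≤ r₁ := by
    have := norm_sub_le (z - x) (y - x)
    rw [sub_sub_sub_cancel_right] at this
    linarith
  have hxy : ‖x - y‖ ≤ r₁ := by
    rw [norm_sub_rev]; linarith [norm_nonneg (y - x)]
  have h1 := hT.near y hy z hz hzy
  have h2 := ((H x).starProjection - (H y).starProjection).le_of_opNorm_le
    ((hT.osc x hx y hy hxy).trans (mul_rpow_le_of_le hκ hC hCr (norm_nonneg _) hxy)) (z - y)
  have h3 := mul_le_mul_of_nonneg_right (mul_rpow_le_of_le hκ hC hCr (norm_nonneg _) hzy)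
    (norm_nonneg (z - y))
  have h4 : z - y = (H x).starProjection (z - y) + ((z - y) - (H y).starProjection (z - y)) -
      ((H x).starProjection - (H y).starProjection) (z - y) := by
    rw [sub_apply]; abel
  have h5 := norm_sub_le
    ((H x).starProjection (z - y) + ((z - y) - (H y).starProjection (z - y)))
    (((H x).starProjection - (H y).starProjection) (z - y))
  have h6 := norm_add_le ((H x).starProjection (z - y)) ((z - y) - (H y).starProjection (z - y))
  rw [← h4] at h5
  linarith

/-- Take `y` minimising the residual `w = ξ - π(y - x)`. If `w ≠ 0`, moving from `y` along the
projection `v` of `w` to `H y` reaches some `z ∈ S` near `y + v`, still in the ball, with residual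
at most `‖w‖/16 + ‖w‖/16`: a contradiction. -/
theorem HasTangentPlanes.exists_projection_eq (hT : HasTangentPlanes m κ C r₁ S H) (hκ : 0 < κ)
    (hC : 0 ≤ C) (hr₁ : 0 < r₁) (hCr : C * r₁ ^ κ ≤ 1 / 16) (hS : IsCompact S) {x : E}
    (hx : x ∈ S) {ξ : E} (hξ : ξ ∈ H x) (hξr : ‖ξ‖ < r₁ / 8) :
    ∃ y ∈ S, ‖y - x‖ ≤ r₁ / 2 ∧ (H x).starProjection (y - x) = ξ := by
  have hcomp : IsCompact (S ∩ closedBall x (r₁ / 2)) := hS.inter_right isClosed_closedBall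
  obtain ⟨y, ⟨hy, hyx⟩, hmin⟩ := hcomp.exists_isMinOn
    (f := fun y => ‖ξ - (H x).starProjection (y - x)‖)
    ⟨x, hx, mem_closedBall_self (half_pos hr₁).le⟩ (by fun_prop)
  rw [mem_closedBall, dist_eq_norm] at hyx
  refine ⟨y, hy, hyx, ?_⟩
  set w := ξ - (H x).starProjection (y - x) with hw
  have hη : ‖w‖ ≤ ‖ξ‖ := by
    have := hmin (show x ∈ S ∩ closedBall x (r₁ / 2) from
      ⟨hx, mem_closedBall_self (half_pos hr₁).le⟩)
    simpa [← hw, -map_sub, ← sub_eq_add_neg] using this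
  by_contra hne
  have hη0 : 0 < ‖w‖ := norm_pos_iff.2 fun h => hne (sub_eq_zero.1 h).symm
  have hwP : w ∈ H x := (H x).sub_mem hξ ((H x).starProjection_apply_mem _)
  -- Comparison with the competitor `x` gives `‖w‖ ≤ ‖ξ‖ < r₁/8`. So the minimiser is well inside
  -- the ball and there is room to move.
  have hyx' : ‖y - x‖ ≤ 8 / 7 * (r₁ / 4) := by
    have h1 := hT.norm_sub_le_projection hκ hC hCr hx hx hy (by simpa using (half_pos hr₁).le) hyx
    have h2 : ‖(H x).starProjection (y - x)‖ ≤ ‖ξ‖ + ‖w‖ := by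
      have : (H x).starProjection (y - x) = ξ - w := by rw [hw]; abel
      rw [this]; exact norm_sub_le _ _
    linarith
  have hxy : ‖x - y‖ ≤ r₁ := by rw [norm_sub_rev]; linarith
  have hosc := ((H x).starProjection - (H y).starProjection).le_of_opNorm_le
    ((hT.osc x hx y hy hxy).trans (mul_rpow_le_of_le hκ hC hCr (norm_nonneg _) hxy)) w
  rw [sub_apply, Submodule.starProjection_eq_self_iff.2 hwP] at hosc
  set v := (H y).starProjection w with hv
  have hvw : ‖v‖ ≤ ‖w‖ := (H y).norm_starProjection_apply_le w
  obtain ⟨z, hz, hzv⟩ := hT.fill y hy v ((H y).starProjection_apply_mem w) (by linarith)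
  have hzv' : ‖y + v - z‖ ≤ 1 / 16 * ‖w‖ :=
    hzv.trans (mul_le_mul (mul_rpow_le_of_le hκ hC hCr (norm_nonneg _) (by linarith)) hvw
      (norm_nonneg _) (by norm_num))
  have hzx : ‖z - x‖ ≤ r₁ / 2 := by
    have : z - x = (y - x) + v - (y + v - z) := by abel
    rw [this]
    linarith [norm_sub_le ((y - x) + v) (y + v - z), norm_add_le (y - x) v]
  have h1 := hmin (show z ∈ S ∩ closedBall x (r₁ / 2) from
    ⟨hz, by rwa [mem_closedBall, dist_eq_norm]⟩)
  simp only [mem_ofPred_eq] at h1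
  rw [← hw] at h1
  have h2 : ξ - (H x).starProjection (z - x) =
      (H x).starProjection (w - v) + (H x).starProjection (y + v - z) := by
    have : z - x = (y - x) + v - (y + v - z) := by abel
    rw [this, map_sub _ (y - x + v), map_add, map_sub _ w,
      Submodule.starProjection_eq_self_iff.2 hwP, hw]
    abel
  rw [h2] at h1
  have h3 := norm_add_le ((H x).starProjection (w - v)) ((H x).starProjection (y + v - z))
  have h4 := (H x).norm_starProjection_apply_le (w - v)
  have h5 := (H x).norm_starProjection_apply_le (y + v - z)
  linarith

/-- The vector `u + Lu ∈ Q` has length at most `2‖u‖`, hence distance at most `2‖Q - Q'‖‖u‖` from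
`Q'`; `hL'` doubles this. -/
theorem norm_graph_linearMap_sub_le {P Q Q' : Submodule ℝ E} {L L' : P →L[ℝ] Pᗮ} (hL : ‖L‖ ≤ 1)
    (hLQ : ∀ u : P, (u : E) + L u ∈ Q)
    (hL' : ∀ v : E, ‖Pᗮ.orthogonalProjectionOnto v - L' (P.orthogonalProjectionOnto v)‖ ≤
      2 * ‖v - Q'.starProjection v‖) :
    ‖L - L'‖ ≤ 4 * ‖Q.starProjection - Q'.starProjection‖ := by
  refine ContinuousLinearMap.opNorm_le_bound _ (by positivity) fun u => ?_
  have h1 := hL' ((u : E) + L u)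
  have h2 : Pᗮ.orthogonalProjectionOnto ((u : E) + L u) = L u := by
    rw [map_add, Submodule.orthogonalProjectionOnto_mem_subspace_eq_self (L u),
      Submodule.orthogonalProjectionOnto_orthogonal_apply_eq_zero (u.2), zero_add]
  have h3 : P.orthogonalProjectionOnto ((u : E) + L u) = u := by
    rw [map_add, Submodule.orthogonalProjectionOnto_mem_subspace_eq_self u,
      Submodule.orthogonalProjectionOnto_eq_zero_iff.2 (L u).2, add_zero]
  rw [h2, h3] at h1
  have h4 := (Q.starProjection - Q'.starProjection).le_opNorm ((u : E) + L u)
  rw [sub_apply, Submodule.starProjection_eq_self_iff.2 (hLQ u)] at h4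
  have h5 : ‖(u : E) + L u‖ ≤ 2 * ‖u‖ := by
    have := norm_add_le (u : E) (L u)
    have := L.le_of_opNorm_le hL u
    simp only [Submodule.coe_norm] at *
    linarith
  rw [sub_apply]
  have := mul_le_mul_of_nonneg_left h5 (norm_nonneg (Q.starProjection - Q'.starProjection))
  linarith

/-- Near each of its points, a set with tangent planes is the graph of a function over the tangent
plane, with Hölder continuous derivative. -/
theorem HasTangentPlanes.exists_local_graph (hT : HasTangentPlanes m κ C r₁ S H) (hκ : 0 < κ)
    (hκ1 : κ ≤ 1) (hC : 0 ≤ C) (hr₁ : 0 < r₁) (hCr : C * r₁ ^ κ ≤ 1 / 16) (hS : IsCompact S) {x : E}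
    (hx : x ∈ S) :
    ∃ (f : H x → (H x)ᗮ) (D : H x → H x →L[ℝ] (H x)ᗮ), f 0 = 0 ∧ D 0 = 0 ∧
      (∀ ξ ∈ ball (0 : H x) (r₁ / 8), HasFDerivAt f (D ξ) ξ) ∧ (∀ ξ, ‖D ξ‖ ≤ 1) ∧
      (∀ ξ ∈ ball (0 : H x) (r₁ / 8), ∀ ζ ∈ ball (0 : H x) (r₁ / 8),
        ‖D ξ - D ζ‖ ≤ 8 * C * ‖ξ - ζ‖ ^ κ) ∧
      (∀ ξ ∈ ball (0 : H x) (r₁ / 8), x + (ξ + f ξ) ∈ S) ∧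
      ∀ y ∈ S, ‖y - x‖ < r₁ / 8 → ∃ ξ ∈ ball (0 : H x) (r₁ / 8), y = x + (ξ + f ξ) := by
  have hY : ∀ ξ : H x, ∃ y, ξ ∈ ball (0 : H x) (r₁ / 8) → y ∈ S ∧ ‖y - x‖ ≤ r₁ / 2 ∧
      (H x).orthogonalProjectionOnto (y - x) = ξ := by
    intro ξ
    by_cases hξ : ξ ∈ ball (0 : H x) (r₁ / 8)
    · obtain ⟨y, hy, hyx, hyξ⟩ := hT.exists_projection_eq hκ hC hr₁ hCr hS hx ξ.2
        (by simpa using hξ)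
      refine ⟨y, fun _ => ⟨hy, hyx, ?_⟩⟩
      rw [Submodule.starProjection_apply] at hyξ
      exact Subtype.ext hyξ
    · exact ⟨x, fun h => absurd h hξ⟩
  choose Y hY using hY
  have hL : ∀ y, ∃ L : H x →L[ℝ] (H x)ᗮ, ‖L‖ ≤ 1 ∧ (y ∈ S → ‖y - x‖ ≤ r₁ / 2 →
      (∀ u : H x, (u : E) + L u ∈ H y) ∧
      ∀ v : E, ‖(H x)ᗮ.orthogonalProjectionOnto v - L ((H x).orthogonalProjectionOnto v)‖ ≤
        2 * ‖v - (H y).starProjection v‖) := by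
    intro y
    by_cases hy : y ∈ S ∧ ‖y - x‖ ≤ r₁ / 2
    · have hxy : ‖x - y‖ ≤ r₁ := by rw [norm_sub_rev]; linarith [hy.2]
      obtain ⟨L, h1, h2, h3⟩ := exists_graph_linearMap (H x) (H y)
        ((hT.osc x hx y hy.1 hxy).trans (mul_rpow_le_of_le hκ hC hCr (norm_nonneg _) hxy))
      exact ⟨L, h1, fun _ _ => ⟨h2, h3⟩⟩
    · exact ⟨0, ContinuousLinearMap.opNorm_le_bound _ zero_le_one (by simp),
        fun h1 h2 => absurd ⟨h1, h2⟩ hy⟩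
  choose L hL1 hL2 using hL
  have hYsub : ∀ ξ ∈ ball (0 : H x) (r₁ / 8), ∀ ζ ∈ ball (0 : H x) (r₁ / 8),
      ‖Y ξ - Y ζ‖ ≤ 2 * ‖ξ - ζ‖ := by
    intro ξ hξ ζ hζ
    obtain ⟨h1, h2, h3⟩ := hY ξ hξ
    obtain ⟨h4, h5, h6⟩ := hY ζ hζ
    have h := hT.norm_sub_le_projection hκ hC hCr hx h4 h1 h5 h2
    have e : (H x).starProjection (Y ξ - Y ζ) = ((ξ - ζ : H x) : E) := by
      rw [Submodule.starProjection_apply, ← sub_sub_sub_cancel_right (Y ξ) (Y ζ) x, map_sub, h3, h6]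
    rw [e, ← Submodule.coe_norm] at h
    linarith [norm_nonneg (ξ - ζ)]
  have huniq : ∀ y ∈ S, ‖y - x‖ ≤ r₁ / 2 → ∀ ξ ∈ ball (0 : H x) (r₁ / 8),
      (H x).orthogonalProjectionOnto (y - x) = ξ → Y ξ = y := by
    intro y hy hyx ξ hξ he
    obtain ⟨h1, h2, h3⟩ := hY ξ hξ
    have h := hT.norm_sub_le_projection hκ hC hCr hx hy h1 hyx h2
    rw [← sub_sub_sub_cancel_right (Y ξ) y x, map_sub, Submodule.starProjection_apply,
      Submodule.starProjection_apply, h3, he, sub_self, norm_zero, mul_zero,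
      sub_sub_sub_cancel_right] at h
    exact norm_sub_eq_zero_iff.1 (le_antisymm h (norm_nonneg _))
  have h0mem : (0 : H x) ∈ ball (0 : H x) (r₁ / 8) := mem_ball_self (by positivity)
  have hY0 : Y 0 = x := huniq x hx (by simpa using (half_pos hr₁).le) 0 h0mem (by simp)
  have hYf : ∀ ξ ∈ ball (0 : H x) (r₁ / 8),
      x + ((ξ : E) + (H x)ᗮ.orthogonalProjectionOnto (Y ξ - x)) = Y ξ := by
    intro ξ hξ
    have h := (H x).starProjection_add_starProjection_orthogonal (Y ξ - x)
    rw [Submodule.starProjection_apply, Submodule.starProjection_apply, (hY ξ hξ).2.2] at h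
    rw [h]; abel
  refine ⟨fun ξ => (H x)ᗮ.orthogonalProjectionOnto (Y ξ - x), fun ξ => L (Y ξ), ?_, ?_, ?_,
    fun ξ => hL1 _, ?_, ?_, ?_⟩
  · simp [hY0]
  · ext u
    -- At the centre, `u + Lu ∈ H x` puts `Lu` in both `H x` and its complement.
    have h := (hL2 x hx (by simpa using (half_pos hr₁).le)).1 u
    have h1 : ((L x u : (H x)ᗮ) : E) ∈ H x := by
      simpa using (H x).sub_mem h u.2
    simp only [hY0]
    have := (H x).inner_right_of_mem_orthogonal h1 (L x u).2
    rw [inner_self_eq_zero] at this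
    simp [this]
  · intro ξ hξ
    rw [hasFDerivAt_iff_isLittleO_nhds_zero]
    have hlim : Filter.Tendsto (fun h : H x => 4 * C * (2 * ‖h‖) ^ κ) (nhds 0) (nhds 0) := by
      have : Continuous fun h : H x => 4 * C * (2 * ‖h‖) ^ κ :=
        continuous_const.mul ((continuous_const.mul continuous_norm).rpow_const
          fun _ => Or.inr hκ.le)
      simpa [Real.zero_rpow hκ.ne'] using this.tendsto 0
    have hev : ∀ᶠ h : H x in nhds 0, ξ + h ∈ ball (0 : H x) (r₁ / 8) := by
      have : Filter.Tendsto (fun h : H x => ξ + h) (nhds 0) (nhds ξ) := by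
        simpa using (continuous_const_add ξ).tendsto (0 : H x)
      exact this.eventually (isOpen_ball.mem_nhds hξ)
    refine Asymptotics.IsLittleO.of_bound fun c hc => ?_
    filter_upwards [hev, hlim.eventually (gt_mem_nhds hc)] with h hh hc'
    have h1 := hYsub _ hh _ hξ
    rw [add_sub_cancel_left] at h1
    obtain ⟨a1, a2, a3⟩ := hY ξ hξ
    obtain ⟨b1, b2, b3⟩ := hY _ hh
    -- Applied to a secant of `S`, this bounds the first-order remainder by twice the distance of
    -- the secant from the tangent plane at `Y ξ`, which is `o(‖h‖)` as `Y` is 2-Lipschitz.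
    have h2 := (hL2 (Y ξ) a1 a2).2 (Y (ξ + h) - Y ξ)
    have e1 : (H x).orthogonalProjectionOnto (Y (ξ + h) - Y ξ) = h := by
      rw [← sub_sub_sub_cancel_right (Y (ξ + h)) (Y ξ) x, map_sub, b3, a3, add_sub_cancel_left]
    have e2 : (H x)ᗮ.orthogonalProjectionOnto (Y (ξ + h) - Y ξ) =
        (H x)ᗮ.orthogonalProjectionOnto (Y (ξ + h) - x) -
          (H x)ᗮ.orthogonalProjectionOnto (Y ξ - x) := by
      rw [← map_sub, sub_sub_sub_cancel_right]
    rw [e1, e2] at h2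
    have hle : ‖Y (ξ + h) - Y ξ‖ ≤ r₁ := by
      have := norm_sub_le (Y (ξ + h) - x) (Y ξ - x)
      rw [sub_sub_sub_cancel_right] at this
      linarith
    have h3 := hT.near _ a1 _ b1 hle
    calc _ ≤ 2 * (C * ‖Y (ξ + h) - Y ξ‖ ^ κ * ‖Y (ξ + h) - Y ξ‖) := h2.trans (by gcongr)
      _ ≤ 2 * (C * (2 * ‖h‖) ^ κ * (2 * ‖h‖)) := by gcongr
      _ = 4 * C * (2 * ‖h‖) ^ κ * ‖h‖ := by ring
      _ ≤ c * ‖h‖ := by gcongr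
  · intro ξ hξ ζ hζ
    obtain ⟨a1, a2, a3⟩ := hY ξ hξ
    obtain ⟨b1, b2, b3⟩ := hY ζ hζ
    have h1 := norm_graph_linearMap_sub_le (hL1 (Y ξ)) (hL2 _ a1 a2).1 (hL2 _ b1 b2).2
    have hle : ‖Y ξ - Y ζ‖ ≤ r₁ := by
      have := norm_sub_le (Y ξ - x) (Y ζ - x)
      rw [sub_sub_sub_cancel_right] at this
      linarith
    have h2 := hT.osc _ a1 _ b1 hle
    have h3 : ‖Y ξ - Y ζ‖ ^ κ ≤ 2 * ‖ξ - ζ‖ ^ κ :=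
      rpow_le_mul_rpow hκ.le hκ1 (norm_nonneg _) (norm_nonneg _) (by norm_num) (hYsub ξ hξ ζ hζ)
    calc _ ≤ 4 * (C * (2 * ‖ξ - ζ‖ ^ κ)) := h1.trans (by gcongr; exact h2.trans (by gcongr))
      _ = _ := by ring
  · intro ξ hξ
    rw [hYf ξ hξ]
    exact (hY ξ hξ).1
  · intro y hy hyx
    have hξ : (H x).orthogonalProjectionOnto (y - x) ∈ ball (0 : H x) (r₁ / 8) := by
      rw [mem_ball_zero_iff]
      exact ((H x).norm_orthogonalProjectionOnto_apply_le _).trans_lt hyx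
    refine ⟨_, hξ, ?_⟩
    rw [hYf _ hξ, huniq y hy (by linarith) _ hξ rfl]

/-- The tangent plane is the span of the tangent directions. -/
theorem HasTangentPlanes.span_tangentConeAt (hT : HasTangentPlanes m κ C r₁ S H) (hκ : 0 < κ)
    (hr₁ : 0 < r₁) {x : E} (hx : x ∈ S) :
    Submodule.span ℝ (tangentConeAt ℝ S x) = H x := by
  refine le_antisymm (Submodule.span_le.2 fun v hv => ?_)
    fun v hv => Submodule.subset_span ?_
  · obtain ⟨α, l, _, c, d, hd, hdS, hcd⟩ := exists_fun_of_mem_tangentConeAt hv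
    rw [SetLike.mem_coe, ← Submodule.starProjection_eq_self_iff, eq_comm, ← sub_eq_zero,
      ← norm_eq_zero]
    have h1 : Filter.Tendsto (fun n => ‖c n • d n - (H x).starProjection (c n • d n)‖) l
        (nhds ‖v - (H x).starProjection v‖) :=
      (hcd.sub (((H x).starProjection.continuous.tendsto v).comp hcd)).norm
    have hdn : Filter.Tendsto (fun n => ‖d n‖) l (nhds 0) := by simpa using hd.norm
    have h2 : Filter.Tendsto (fun n => C * ‖d n‖ ^ κ * ‖c n • d n‖) l (nhds 0) := by
      have := ((hdn.rpow_const (Or.inr hκ.le)).const_mul C).mul hcd.norm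
      simpa [Real.zero_rpow hκ.ne'] using this
    refine tendsto_nhds_unique h1 (squeeze_zero' (Filter.Eventually.of_forall fun _ => norm_nonneg _)
      ?_ h2)
    filter_upwards [hdS, hdn.eventually (gt_mem_nhds hr₁)] with n hn hn'
    have h3 := hT.near x hx _ hn (by rw [add_sub_cancel_left]; exact hn'.le)
    rw [add_sub_cancel_left] at h3
    rw [map_smul, ← smul_sub, norm_smul, norm_smul]
    calc _ ≤ ‖c n‖ * (C * ‖d n‖ ^ κ * ‖d n‖) := by gcongr
      _ = _ := by ring
  · have hc : Filter.Tendsto (fun k : ℕ => ((k : ℝ) + 1)⁻¹) Filter.atTop (nhds 0) := by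
      simpa [one_div] using tendsto_one_div_add_atTop_nhds_zero_nat (𝕜 := ℝ)
    have hcn : Filter.Tendsto (fun k : ℕ => ((k : ℝ) + 1)⁻¹ * ‖v‖) Filter.atTop (nhds 0) := by
      simpa using hc.mul_const ‖v‖
    -- Points of `S` near `x + v/(k+1)`, rescaled by `k+1`, show that every `v ∈ H x` is itself a
    -- tangent direction.
    have hex : ∀ k : ℕ, ∃ y, ‖((k : ℝ) + 1)⁻¹ • v‖ ≤ r₁ → y ∈ S ∧
        ‖x + ((k : ℝ) + 1)⁻¹ • v - y‖ ≤
          C * ‖((k : ℝ) + 1)⁻¹ • v‖ ^ κ * ‖((k : ℝ) + 1)⁻¹ • v‖ := by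
      intro k
      by_cases h : ‖((k : ℝ) + 1)⁻¹ • v‖ ≤ r₁
      · obtain ⟨y, hy, hy'⟩ := hT.fill x hx _ ((H x).smul_mem _ hv) h
        exact ⟨y, fun _ => ⟨hy, hy'⟩⟩
      · exact ⟨x, fun h' => absurd h' h⟩
    choose y hy using hex
    have hnorm : ∀ k : ℕ, ‖((k : ℝ) + 1)⁻¹ • v‖ = ((k : ℝ) + 1)⁻¹ * ‖v‖ := fun k => by
      rw [norm_smul, Real.norm_of_nonneg (by positivity)]
    simp only [hnorm] at hy
    have hev : ∀ᶠ k : ℕ in Filter.atTop, ((k : ℝ) + 1)⁻¹ * ‖v‖ ≤ r₁ :=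
      hcn.eventually (ge_mem_nhds hr₁)
    have hconv : Filter.Tendsto (fun k : ℕ => ((k : ℝ) + 1) • (y k - x)) Filter.atTop
        (nhds v) := by
      rw [tendsto_iff_norm_sub_tendsto_zero]
      have h2 : Filter.Tendsto (fun k : ℕ => C * (((k : ℝ) + 1)⁻¹ * ‖v‖) ^ κ * ‖v‖) Filter.atTop
          (nhds 0) := by
        have := ((hcn.rpow_const (Or.inr hκ.le)).const_mul C).mul_const ‖v‖
        simpa [Real.zero_rpow hκ.ne'] using this
      refine squeeze_zero' (Filter.Eventually.of_forall fun _ => norm_nonneg _) ?_ h2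
      filter_upwards [hev] with k hk
      have hk0 : (0 : ℝ) < (k : ℝ) + 1 := by positivity
      have e : ((k : ℝ) + 1) • (y k - x) - v =
          -(((k : ℝ) + 1) • (x + ((k : ℝ) + 1)⁻¹ • v - y k)) := by
        rw [smul_sub, smul_sub, smul_add, smul_inv_smul₀ hk0.ne']; abel
      rw [e, norm_neg, norm_smul, Real.norm_of_nonneg hk0.le]
      calc _ ≤ ((k : ℝ) + 1) * (C * (((k : ℝ) + 1)⁻¹ * ‖v‖) ^ κ * (((k : ℝ) + 1)⁻¹ * ‖v‖)) := by
            gcongr; exact (hy k hk).2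
        _ = _ := by field_simp
    refine mem_tangentConeAt_of_seq Filter.atTop (fun k : ℕ => (k : ℝ) + 1) (fun k => y k - x)
      ?_ ?_ hconv
    · have := hc.smul hconv
      rw [zero_smul] at this
      refine this.congr fun k => ?_
      rw [inv_smul_smul₀ (by positivity)]
    · filter_upwards [hev] with k hk
      simpa using (hy k hk).1

end LocalGraph

/-! ### Uniform graph patches -/

section GraphPatches

variable {n m : ℕ} {κ : ℝ≥0} {S : Set (EuclideanSpace ℝ (Fin n))}

theorem norm_le_norm_add_of_orthogonal {E : Type*} [NormedAddCommGroup E] [InnerProductSpace ℝ E]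
    {P : Submodule ℝ E} (u : P) (w : Pᗮ) : ‖u‖ ≤ ‖(u : E) + w‖ := by
  have h := norm_add_sq_eq_norm_sq_add_norm_sq_real (P.inner_right_of_mem_orthogonal u.2 w.2)
  rw [Submodule.coe_norm]
  nlinarith [norm_nonneg ((u : E) + w), norm_nonneg (u : E), norm_nonneg (w : E)]

theorem IsC1HolderOn.mono {V W : Type*} [NormedAddCommGroup V] [NormedSpace ℝ V]
    [NormedAddCommGroup W] [NormedSpace ℝ W] {f : V → W} {U U' : Set V}
    (h : IsC1HolderOn κ f U) (hU : U' ⊆ U) : IsC1HolderOn κ f U' :=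
  ⟨h.1.mono hU, h.2.imp fun _ hL => hL.mono hU⟩

theorem isClosedC1HolderManifold_of_hasGraphPatch (hS : IsCompact S) {R K : ℝ} (hR : 0 < R)
    (h : ∀ x ∈ S, HasGraphPatch m κ R K S x) : IsClosedC1HolderManifold m κ S := by
  refine ⟨hS, fun x hx => ?_⟩
  obtain ⟨hP, f, hf, -, -, hg, -⟩ := h x hx
  exact ⟨_, hP, R, hR, f, hf.mono (subset_univ _), hg⟩

theorem c0HolderNormOn_le {V W : Type*} [PseudoMetricSpace V] [NormedAddCommGroup W] {g : V → W}
    {U : Set V} {a b : ℝ} (ha : 0 ≤ a) (hb : 0 ≤ b) (h1 : ∀ ξ ∈ U, ‖g ξ‖ ≤ a)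
    (h2 : ∀ ξ ∈ U, ∀ ζ ∈ U, dist (g ξ) (g ζ) ≤ b * dist ξ ζ ^ (κ : ℝ)) :
    c0HolderNormOn κ g U ≤ ENNReal.ofReal (a + b) := by
  rw [ENNReal.ofReal_add ha hb]
  refine add_le_add (iSup₂_le fun ξ hξ => ?_) ?_
  · rw [← ofReal_norm]
    exact ENNReal.ofReal_le_ofReal (h1 ξ hξ)
  · have hol := holderOnWith_of_dist_le h2
    have : HolderWith b.toNNReal κ (U.domRestrict g) := fun ξ ζ => hol ξ ξ.2 ζ ζ.2
    exact this.eHolderNorm_le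

theorem HasTangentPlanes.hasGraphPatch {C r₁ : ℝ}
    {H : EuclideanSpace ℝ (Fin n) → Submodule ℝ (EuclideanSpace ℝ (Fin n))}
    (hT : HasTangentPlanes m κ C r₁ S H) (hκ : 0 < κ) (hκ1 : κ ≤ 1) (hC : 0 ≤ C) (hr₁ : 0 < r₁)
    (hCr : C * r₁ ^ (κ : ℝ) ≤ 1 / 16) (hS : IsCompact S) {R K : ℝ} (hR : R ≤ r₁ / 32)
    (hK : 1 + 8 * C ≤ K) {x : EuclideanSpace ℝ (Fin n)} (hx : x ∈ S) :
    HasGraphPatch m κ R K S x := by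
  -- The type of `f` depends on the plane, so the equality of the tangent space with `H x` is
  -- substituted with the plane generalised.
  suffices key : ∀ P : Submodule ℝ (EuclideanSpace ℝ (Fin n)), P = H x →
      (P ∈ Gr n m ∧ ∃ f : P → Pᗮ, IsC1HolderOn κ f univ ∧ f 0 = 0 ∧ fderiv ℝ f 0 = 0 ∧
        IsGraphNear S x R P f ∧
        c0HolderNormOn κ (fderiv ℝ f) (closedBall 0 R) ≤ ENNReal.ofReal K) from
    key _ (hT.span_tangentConeAt (NNReal.coe_pos.2 hκ) hr₁ hx)
  rintro P rfl
  refine ⟨hT.finrank_eq x hx, ?_⟩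
  obtain ⟨f, D, hf0, hD0, hfD, hDb, hDh, hfS, hSf⟩ := hT.exists_local_graph (NNReal.coe_pos.2 hκ)
    (NNReal.coe_le_one.2 hκ1) hC hr₁ hCr hS hx
  obtain ⟨g, hg, hgf⟩ := exists_c1Holder_extension hκ hκ1 (by positivity : 0 < r₁ / 8)
    (by positivity) hfD hDh
  have hsub : ball (0 : H x) (r₁ / 8 / 2) ⊆ ball 0 (r₁ / 8) := ball_subset_ball (by linarith)
  have hgD : ∀ ξ ∈ ball (0 : H x) (r₁ / 8 / 2), fderiv ℝ g ξ = D ξ := fun ξ hξ => by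
    rw [(hgf.eventuallyEq_of_mem (isOpen_ball.mem_nhds hξ)).fderiv_eq]
    exact (hfD ξ (hsub hξ)).fderiv
  have h0 : (0 : H x) ∈ ball (0 : H x) (r₁ / 8 / 2) := mem_ball_self (by positivity)
  -- As `R ≤ r₁/32 < r₁/16`, the extension agrees with `f` on the whole patch: a point of the graph
  -- in the `R`-ball has base coordinate of norm less than `R`.
  have hRsub : closedBall (0 : H x) R ⊆ ball 0 (r₁ / 8 / 2) :=
    closedBall_subset_ball (by linarith)
  refine ⟨g, hg, by rw [hgf h0, hf0], by rw [hgD 0 h0, hD0], ?_, ?_⟩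
  · refine Subset.antisymm ?_ ?_
    · rintro y ⟨hy, hyx⟩
      rw [mem_ball, dist_eq_norm] at hyx
      obtain ⟨ξ, hξ, rfl⟩ := hSf y hy (by linarith)
      rw [add_sub_cancel_left] at hyx
      have hξR : ξ ∈ ball (0 : H x) (r₁ / 8 / 2) := hRsub <| by
        rw [mem_closedBall_zero_iff]
        exact (norm_le_norm_add_of_orthogonal ξ (f ξ)).trans hyx.le
      exact ⟨_, ⟨⟨ξ, by simp only [hgf hξR]⟩, by rwa [mem_ball_zero_iff]⟩, rfl⟩
    · rintro _ ⟨_, ⟨⟨ξ, rfl⟩, hξ⟩, rfl⟩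
      rw [mem_ball_zero_iff] at hξ
      have hξR : ξ ∈ ball (0 : H x) (r₁ / 8 / 2) := hRsub <| by
        rw [mem_closedBall_zero_iff]
        exact (norm_le_norm_add_of_orthogonal ξ (g ξ)).trans hξ.le
      refine ⟨?_, by simpa [dist_eq_norm] using hξ⟩
      simp only [hgf hξR]
      exact hfS ξ (hsub hξR)
  · refine (c0HolderNormOn_le zero_le_one (by positivity : 0 ≤ 8 * C) (fun ξ hξ => ?_)
      fun ξ hξ ζ hζ => ?_).trans (ENNReal.ofReal_le_ofReal hK)
    · rw [hgD ξ (hRsub hξ)]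
      exact hDb ξ
    · rw [hgD ξ (hRsub hξ), hgD ζ (hRsub hζ), dist_eq_norm, dist_eq_norm]
      exact hDh ξ (hsub (hRsub hξ)) ζ (hsub (hRsub hζ))

/-- Flat approximations with a Hölder rate yield uniform graph patches. -/
theorem exists_hasGraphPatch (n m : ℕ) (hκ : 0 < κ) (hκ1 : κ ≤ 1) {C r₀ : ℝ} (hC : 0 ≤ C)
    (hr₀ : 0 < r₀) :
    ∃ R₀ K₀ : ℝ, 0 < R₀ ∧ 0 < K₀ ∧ ∀ R K : ℝ, R ≤ R₀ → K₀ ≤ K →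
      ∀ S : Set (EuclideanSpace ℝ (Fin n)), IsCompact S → HasFlatApprox m κ C r₀ S →
        ∀ x ∈ S, HasGraphPatch m κ R K S x := by
  obtain ⟨C', r₁, hC', hr₁, hCr, h⟩ := exists_hasTangentPlanes
    (E := EuclideanSpace ℝ (Fin n)) (NNReal.coe_pos.2 hκ) (NNReal.coe_le_one.2 hκ1) hC hr₀
  refine ⟨r₁ / 32, 1 + 8 * C', by positivity, by positivity, fun R K hR hK S hS hflat x hx => ?_⟩
  obtain ⟨H, hT⟩ := h m S hflat
  exact hT.hasGraphPatch hκ hκ1 hC' hr₁ hCr hS hR hK hx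

end GraphPatches

/-! ### Volume of simplices with large heights -/

section Volume

theorem euclideanHausdorffMeasure_image_le {X Y : Type*} [EMetricSpace X] [EMetricSpace Y]
    [MeasurableSpace X] [BorelSpace X] [MeasurableSpace Y] [BorelSpace Y] {f : X → Y}
    (hf : LipschitzWith 1 f) (k : ℕ) (s : Set X) : μHE[k] (f '' s) ≤ μHE[k] s := by
  rw [Measure.euclideanHausdorffMeasure_def, Measure.euclideanHausdorffMeasure_def,
    Measure.smul_apply, Measure.smul_apply]
  gcongr
  simpa using hf.hausdorffMeasure_image_le (Nat.cast_nonneg k) s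

/-- The standard simplex with vertices `0` and the standard basis vectors. -/
def cornerSimplex (k : ℕ) : Set (EuclideanSpace ℝ (Fin k)) :=
  convexHull ℝ (insert 0 (range (EuclideanSpace.basisFun (Fin k) ℝ)))

theorem volume_cornerSimplex_pos (k : ℕ) : 0 < volume (cornerSimplex k) := by
  refine Measure.measure_pos_of_nonempty_interior _ ?_
  rw [cornerSimplex, interior_convexHull_nonempty_iff_affineSpan_eq_top, ← SetLike.coe_set_eq,
    affineSpan_insert_zero, ← OrthonormalBasis.coe_toBasis, Module.Basis.span_eq]
  rfl

theorem volume_cornerSimplex_lt_top (k : ℕ) : volume (cornerSimplex k) < ⊤ :=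
  Bornology.IsBounded.measure_lt_top
    (isBounded_convexHull.2 ((finite_range _).insert _).isBounded)

variable {E : Type*} [NormedAddCommGroup E] [InnerProductSpace ℝ E]

/-- The coordinates with respect to a family of vectors. -/
noncomputable def coordMap {k : ℕ} (e : Fin k → E) : E →ₗ[ℝ] EuclideanSpace ℝ (Fin k) :=
  (WithLp.linearEquiv 2 ℝ (Fin k → ℝ)).symm.toLinearMap ∘ₗ LinearMap.pi fun i => innerₗ E (e i)

theorem coordMap_apply {k : ℕ} (e : Fin k → E) (w : E) (i : Fin k) :
    coordMap e w i = inner ℝ (e i) w := rfl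

theorem lipschitzWith_coordMap {k : ℕ} {e : Fin k → E} (he : Orthonormal ℝ e) :
    LipschitzWith 1 (coordMap e) := by
  refine LipschitzWith.of_dist_le_mul fun a b => ?_
  rw [NNReal.coe_one, one_mul, dist_eq_norm, dist_eq_norm, ← map_sub]
  refine le_of_sq_le_sq ?_ (norm_nonneg _)
  rw [EuclideanSpace.norm_sq_eq]
  exact he.sum_inner_products_le (s := Finset.univ) (a - b)

theorem image_coordMap_convexHull {k : ℕ} (e v : Fin k → E) :
    coordMap e '' convexHull ℝ (insert 0 (range v)) =
      Matrix.toLpLin 2 2 (Matrix.of fun i j => inner ℝ (e i) (v j)) '' cornerSimplex k := by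
  rw [cornerSimplex, LinearMap.image_convexHull, LinearMap.image_convexHull, image_insert_eq,
    image_insert_eq, map_zero, map_zero, ← range_comp, ← range_comp]
  congr 3
  ext j i
  simp [coordMap_apply, Matrix.toLpLin_apply]

theorem det_eq_prod_of_forall_lt {k : ℕ} {e v : Fin k → E}
    (hev : ∀ i j, j < i → inner ℝ (e i) (v j) = 0) :
    LinearMap.det (Matrix.toLpLin 2 2 (Matrix.of fun i j => inner ℝ (e i) (v j))) =
      ∏ i, inner ℝ (e i) (v i) := by
  rw [Matrix.toLpLin_eq_toLin, LinearMap.det_toLin, Matrix.det_of_isUpperTriangular]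
  · rfl
  · exact fun i j hij => hev i j hij

-- By Bessel's inequality, taking coordinates along `e` does not increase the measure. The image is
-- the corner simplex under an upper triangular matrix whose diagonal entries are at least `δ`.
open scoped Pointwise in
theorem le_euclideanHausdorffMeasure_convexHull [MeasurableSpace E] [BorelSpace E] {k : ℕ}
    {e v : Fin k → E} (he : Orthonormal ℝ e) (hev : ∀ i j, j < i → inner ℝ (e i) (v j) = 0)
    {δ : ℝ} (hδ : 0 ≤ δ) (hv : ∀ i, δ ≤ inner ℝ (e i) (v i)) (z : E) :
    ENNReal.ofReal (δ ^ k) * volume (cornerSimplex k) ≤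
      μHE[k] (convexHull ℝ (insert z (range fun i => z + v i))) := by
  have h1 : insert z (range fun i => z + v i) = z +ᵥ insert (0 : E) (range v) := by
    rw [← image_vadd, image_insert_eq, ← range_comp, vadd_eq_add, add_zero]
    rfl
  rw [h1, convexHull_vadd, measure_vadd]
  refine le_trans ?_ (euclideanHausdorffMeasure_image_le (lipschitzWith_coordMap he) k _)
  rw [image_coordMap_convexHull, EuclideanSpace.euclideanHausdorffMeasure_eq_volume,
    Measure.addHaar_image_linearMap, det_eq_prod_of_forall_lt hev]
  gcongr
  rw [abs_of_nonneg (Finset.prod_nonneg fun i _ => hδ.trans (hv i))]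
  calc δ ^ k = ∏ _i : Fin k, δ := by simp
    _ ≤ _ := Finset.prod_le_prod (fun _ _ => hδ) fun i _ => hv i

theorem exists_submodule_ge_finrank_eq [FiniteDimensional ℝ E] {m : ℕ}
    (hm : m ≤ Module.finrank ℝ E) (W : Submodule ℝ E) (hW : Module.finrank ℝ W ≤ m) :
    ∃ P : Submodule ℝ E, W ≤ P ∧ Module.finrank ℝ P = m := by
  induction m, hW using Nat.le_induction with
  | base => exact ⟨W, le_rfl, rfl⟩
  | succ k _ ih =>
    obtain ⟨P, hWP, hP⟩ := ih (by omega)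
    obtain ⟨v, -, hv⟩ := SetLike.exists_of_lt (lt_top_iff_ne_top.2 (fun h : P = ⊤ => by
      rw [h, finrank_top] at hP
      omega))
    exact ⟨P ⊔ Submodule.span ℝ {v}, hWP.trans le_sup_left, by
      rw [Submodule.finrank_sup_span_singleton hv, hP]⟩

/-- If a set is not close to any `m`-plane through `z`, it contains the vertices of an
`(m + 1)`-simplex with large heights. -/
theorem exists_orthonormal_of_forall_plane [FiniteDimensional ℝ E] {m : ℕ}
    (hm : m ≤ Module.finrank ℝ E) {T : Set E} {z : E} {δ : ℝ} (hδ : 0 < δ)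
    (h : ∀ P : Submodule ℝ E, Module.finrank ℝ P = m →
      ∃ y ∈ T, δ < ‖(y - z) - P.starProjection (y - z)‖) :
    ∃ e v : Fin (m + 1) → E, Orthonormal ℝ e ∧ (∀ i j, j < i → inner ℝ (e i) (v j) = 0) ∧
      (∀ i, δ ≤ inner ℝ (e i) (v i)) ∧ ∀ i, z + v i ∈ T := by
  have hex : ∀ W : Submodule ℝ E, ∃ u, Module.finrank ℝ W ≤ m →
      z + u ∈ T ∧ δ < ‖u - W.starProjection u‖ := by
    intro W
    by_cases hW : Module.finrank ℝ W ≤ m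
    · obtain ⟨P, hWP, hP⟩ := exists_submodule_ge_finrank_eq hm W hW
      obtain ⟨y, hy, hy'⟩ := h P hP
      refine ⟨y - z, fun _ => ⟨by simpa using hy, hy'.trans_le ?_⟩⟩
      exact norm_sub_starProjection_le_of_mem P _ (hWP (W.starProjection_apply_mem _))
    · exact ⟨0, fun h' => absurd h' hW⟩
  choose F hF using hex
  -- Greedy choice: `W i` is spanned by the first `i` chosen vectors, and the next is far from it.
  -- Since `dim W i ≤ m` for `i ≤ m`, the choice can be made `m + 1` times.
  obtain ⟨W, hW0, hWs⟩ : ∃ W : ℕ → Submodule ℝ E, W 0 = ⊥ ∧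
      ∀ i, W (i + 1) = W i ⊔ Submodule.span ℝ {F (W i)} :=
    ⟨fun i => Nat.rec (⊥ : Submodule ℝ E) (fun _ V => V ⊔ Submodule.span ℝ {F V}) i, rfl,
      fun _ => rfl⟩
  have hWmono : Monotone W := monotone_nat_of_le_succ fun i => by rw [hWs]; exact le_sup_left
  have hFW : ∀ i j, j < i → F (W j) ∈ W i := fun i j hij =>
    hWmono (Nat.succ_le_of_lt hij) (by
      rw [Nat.succ_eq_add_one, hWs]
      exact le_sup_right (a := W j) (Submodule.mem_span_singleton_self _))
  have hfin : ∀ i, Module.finrank ℝ (W i) ≤ i := by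
    intro i
    induction i with
    | zero => rw [hW0, finrank_bot]
    | succ i ih =>
      rw [hWs]
      have h1 := Submodule.finrank_add_le_finrank_add_finrank (W i) (Submodule.span ℝ {F (W i)})
      have h2 : Module.finrank ℝ (Submodule.span ℝ {F (W i)}) ≤ 1 :=
        (finrank_span_le_card {F (W i)}).trans_eq (by simp)
      omega
  -- The Gram–Schmidt residuals: their lengths are the heights, and once normalised they form `e`.
  let g : ℕ → E := fun i => F (W i) - (W i).starProjection (F (W i))
  have hgδ : ∀ i ≤ m, δ < ‖g i‖ := fun i hi => (hF (W i) ((hfin i).trans hi)).2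
  have hgo : ∀ i, ∀ w ∈ W i, inner ℝ (g i) w = 0 := fun i w hw =>
    (W i).starProjection_inner_eq_zero _ w hw
  have hgW : ∀ i, g i ∈ W (i + 1) := fun i =>
    (W (i + 1)).sub_mem (hFW _ _ i.lt_succ_self)
      (hWmono i.le_succ ((W i).starProjection_apply_mem _))
  have hgF : ∀ i, inner ℝ (g i) (F (W i)) = ‖g i‖ * ‖g i‖ := by
    intro i
    have : F (W i) = g i + (W i).starProjection (F (W i)) := by simp [g]
    rw [this, inner_add_right, hgo i _ ((W i).starProjection_apply_mem _), add_zero,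
      real_inner_self_eq_norm_mul_norm]
  have hpos : ∀ i : Fin (m + 1), 0 < ‖g i‖ := fun i =>
    hδ.trans (hgδ i (Nat.lt_succ_iff.1 i.2))
  refine ⟨fun i => ‖g i‖⁻¹ • g i, fun i => F (W i), ⟨fun i => ?_, ?_⟩, fun i j hij => ?_,
    fun i => ?_, fun i => ?_⟩
  · rw [norm_smul, norm_inv, norm_norm, inv_mul_cancel₀ (hpos i).ne']
  · have key : ∀ i j : Fin (m + 1), j < i →
        inner ℝ (‖g i‖⁻¹ • g i) (‖g j‖⁻¹ • g j) = 0 := fun i j hij => by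
      rw [inner_smul_left, inner_smul_right, hgo i _ (hWmono (Nat.succ_le_of_lt hij) (hgW j)),
        mul_zero, mul_zero]
    intro i j hij
    rcases lt_or_gt_of_ne hij with h' | h'
    · rw [real_inner_comm]; exact key j i h'
    · exact key i j h'
  · rw [inner_smul_left, hgo i _ (hFW i j hij), mul_zero]
  · rw [inner_smul_left, hgF, RCLike.conj_to_real, inv_mul_cancel_left₀ (hpos i).ne']
    exact (hgδ i (Nat.lt_succ_iff.1 i.2)).le
  · exact (hF (W i) ((hfin i).trans (Nat.lt_succ_iff.1 i.2))).1

end Volume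

/-! ### Decay of the beta numbers from the curvature integral -/

section Decay

variable {n m : ℕ} {A M : ℝ} {S : Set (EuclideanSpace ℝ (Fin n))}

theorem infEDist_plane (x y : EuclideanSpace ℝ (Fin n))
    (P : Submodule ℝ (EuclideanSpace ℝ (Fin n))) :
    infEDist y (plane x P) = ENNReal.ofReal ‖(y - x) - P.starProjection (y - x)‖ := by
  refine le_antisymm ?_ ?_
  · have hmem : x + P.starProjection (y - x) ∈ plane x P :=
      ⟨_, P.starProjection_apply_mem _, rfl⟩
    refine (infEDist_le_edist_of_mem hmem).trans_eq ?_
    rw [edist_dist, dist_eq_norm, sub_sub]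
  · refine le_infEDist.2 ?_
    rintro _ ⟨h, hh, rfl⟩
    rw [edist_dist, dist_eq_norm, ← sub_sub]
    exact ENNReal.ofReal_le_ofReal (norm_sub_starProjection_le_of_mem P _ hh)

/-- The flat plane passes through `z`, whereas `beta` requires planes through `x`; recentring
doubles the error. -/
theorem beta_le {x z : EuclideanSpace ℝ (Fin n)} (hx : x ∈ S) {r δ : ℝ} (hr : 0 < r)
    {P : Submodule ℝ (EuclideanSpace ℝ (Fin n))} (hP : Module.finrank ℝ P = m)
    (h : ∀ y ∈ S ∩ ball x r, ‖(y - z) - P.starProjection (y - z)‖ ≤ δ) :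
    beta m S x r ≤ ENNReal.ofReal (2 * δ / r) := by
  rw [ENNReal.ofReal_div_of_pos hr]
  refine ENNReal.div_le_div_right (iInf₂_le_of_le P hP (iSup₂_le fun y hy => ?_)) _
  rw [infEDist_plane]
  refine ENNReal.ofReal_le_ofReal ?_
  have h1 := h y hy
  have h2 := h x ⟨hx, mem_ball_self hr⟩
  have h3 := norm_sub_le ((y - z) - P.starProjection (y - z)) ((x - z) - P.starProjection (x - z))
  rw [sub_sub_sub_comm, ← map_sub, sub_sub_sub_cancel_right] at h3
  linarith

theorem exists_plane_of_theta_lt {x : EuclideanSpace ℝ (Fin n)} {r t : ℝ} (hr : 0 < r)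
    (h : theta m S x r < ENNReal.ofReal t) :
    ∃ P : Submodule ℝ (EuclideanSpace ℝ (Fin n)), Module.finrank ℝ P = m ∧
      (∀ y ∈ S, ‖y - x‖ ≤ r → ‖(y - x) - P.starProjection (y - x)‖ ≤ t * r) ∧
      ∀ v ∈ P, ‖v‖ ≤ r → ∃ y ∈ S, ‖x + v - y‖ ≤ t * r := by
  have hr' : ENNReal.ofReal r ≠ 0 := by simpa using hr
  rw [theta, ENNReal.div_lt_iff (Or.inl hr') (Or.inl ENNReal.ofReal_ne_top),
    ← ENNReal.ofReal_mul' hr.le] at h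
  simp only [iInf_lt_iff] at h
  obtain ⟨P, hP, h⟩ := h
  refine ⟨P, hP, fun y hy hyx => ?_, fun v hv hvr => ?_⟩
  · have h1 : infEDist y (plane x P ∩ closedBall x r) < ENNReal.ofReal (t * r) :=
      lt_of_le_of_lt ((le_iSup₂_of_le (f := fun y _ => infEDist y (plane x P ∩ closedBall x r))
        y ⟨hy, by rwa [mem_closedBall, dist_eq_norm]⟩ le_rfl).trans le_self_add) h
    have h2 := (infEDist_anti inter_subset_left).trans_lt h1
    rw [infEDist_plane] at h2
    exact (ENNReal.ofReal_lt_ofReal_iff'.1 h2).1.le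
  · have h1 : infEDist (x + v) (S ∩ closedBall x r) < ENNReal.ofReal (t * r) :=
      lt_of_le_of_lt ((le_iSup₂_of_le (f := fun y _ => infEDist y (S ∩ closedBall x r))
        (x + v) ⟨⟨v, hv, rfl⟩, by simpa [dist_eq_norm] using hvr⟩ le_rfl).trans le_add_self) h
    obtain ⟨y, hy, h2⟩ := infEDist_lt_iff.1 h1
    rw [edist_dist, dist_eq_norm] at h2
    exact ⟨y, hy.1, (ENNReal.ofReal_lt_ofReal_iff'.1 h2).1.le⟩

theorem rpow_le_rpow_mul_rpow_sub {r d a κ : ℝ} (hr : 0 < r) (hrd : r ≤ d) (h : κ ≤ a) :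
    r ^ a ≤ d ^ (a - κ) * r ^ κ := by
  calc r ^ a = r ^ (a - κ) * r ^ κ := by rw [← Real.rpow_add hr, sub_add_cancel]
    _ ≤ _ := by gcongr

/-- In a fine set, one-sided flatness with a Hölder rate implies bilateral flatness. -/
theorem IsFineWith.hasFlatApprox (hS : IsFineWith m A M S) (hd : 0 < diam S) {B a κ : ℝ}
    (hB : 0 < B) (hκ : κ ≤ a)
    (h : ∀ x ∈ S, ∀ r : ℝ, 0 < r → r ≤ diam S → ∃ (z : EuclideanSpace ℝ (Fin n))
      (P : Submodule ℝ (EuclideanSpace ℝ (Fin n))), Module.finrank ℝ P = m ∧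
      ∀ y ∈ S ∩ ball x r, ‖(y - z) - P.starProjection (y - z)‖ ≤ B * r ^ a * r) :
    HasFlatApprox m κ (4 * M * B * diam S ^ (a - κ)) (diam S) S := by
  intro x hx r hr hrd
  have hM : 0 < M := by linarith [hS.two_le_M]
  obtain ⟨z, P, hP, hz⟩ := h x hx r hr hrd
  have h1 := (hS.holes x hx r hr hrd).trans
    (mul_le_mul_right (beta_le hx hr hP hz) (ENNReal.ofReal M))
  rw [← ENNReal.ofReal_mul hM.le] at h1
  have hpos : 0 < diam S ^ (a - κ) * r ^ κ := by positivity
  refine exists_plane_of_theta_lt hr (h1.trans_lt ((ENNReal.ofReal_lt_ofReal_iff ?_).2 ?_))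
  · positivity
  -- Fineness gives `2MBr^a`; the constant 4 leaves room for the strict inequality that selects a
  -- plane without attaining the infimum.
  · have h2 := mul_le_mul_of_nonneg_left (rpow_le_rpow_mul_rpow_sub hr hrd hκ)
      (by positivity : 0 ≤ M * B)
    have h3 := mul_pos (mul_pos hM hB) hpos
    calc M * (2 * (B * r ^ a * r) / r) = 2 * (M * B * r ^ a) := by field_simp
      _ < 4 * (M * B * (diam S ^ (a - κ) * r ^ κ)) := by linarith
      _ = _ := by ring

/-- Chebyshev's argument: otherwise `K^p` would exceed the threshold throughout `S ∩ B(x,r)`, whose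
measure is at least `A r^m`, and the integral would be at least `2 max E 1`. The maximum keeps the
threshold positive. Only a constant is integrated below `K^p`, so `K` need not be measurable. -/
theorem IsFineWith.exists_le_of_lintegral_le (hS : IsFineWith m A M S)
    {K : EuclideanSpace ℝ (Fin n) → ℝ≥0∞} {p E : ℝ} (hp : 0 < p)
    (hK : (∫⁻ z in S, K z ^ p ∂μHE[m]) ≤ ENNReal.ofReal E) {x : EuclideanSpace ℝ (Fin n)}
    (hx : x ∈ S) {r : ℝ} (hr : 0 < r) (hrd : r ≤ diam S) :
    ∃ z ∈ S ∩ ball x r, K z ≤ ENNReal.ofReal ((2 * max E 1 / (A * r ^ m)) ^ p⁻¹) := by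
  by_contra! hcon
  have hA := hS.A_pos
  set e := max E 1
  have he : 0 < e := lt_of_lt_of_le one_pos (le_max_right _ _)
  have hpow : ∀ z ∈ S ∩ ball x r, ENNReal.ofReal (2 * e / (A * r ^ m)) ≤ K z ^ p := by
    intro z hz
    have := ENNReal.rpow_le_rpow (hcon z hz).le hp.le
    rwa [ENNReal.ofReal_rpow_of_nonneg (by positivity) hp.le,
      Real.rpow_inv_rpow (by positivity) hp.ne'] at this
  have hmeas : MeasurableSet (S ∩ ball x r) := hS.isCompact.measurableSet.inter measurableSet_ball
  have h1 : ENNReal.ofReal (2 * e) ≤ ENNReal.ofReal e :=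
    calc ENNReal.ofReal (2 * e) = ENNReal.ofReal (2 * e / (A * r ^ m)) *
          ENNReal.ofReal (A * r ^ m) := by
          rw [← ENNReal.ofReal_mul (by positivity), div_mul_cancel₀ _ (by positivity)]
      _ ≤ ENNReal.ofReal (2 * e / (A * r ^ m)) * μHE[m] (S ∩ ball x r) := by
          gcongr
          exact hS.ahlfors x hx r hr hrd
      _ = ∫⁻ _z in S ∩ ball x r, ENNReal.ofReal (2 * e / (A * r ^ m)) ∂μHE[m] :=
          (setLIntegral_const _ _).symm
      _ ≤ ∫⁻ z in S ∩ ball x r, K z ^ p ∂μHE[m] := setLIntegral_mono' hmeas hpow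
      _ ≤ ∫⁻ z in S, K z ^ p ∂μHE[m] := lintegral_mono_set inter_subset_left
      _ ≤ ENNReal.ofReal E := hK
      _ ≤ ENNReal.ofReal e := ENNReal.ofReal_le_ofReal (le_max_left _ _)
  rw [ENNReal.ofReal_le_ofReal_iff he.le] at h1
  linarith

theorem rpow_inv_mul_self {A p r e : ℝ} (hA : 0 < A) (hr : 0 < r) (he : 0 < e) :
    (2 * e / (A * r ^ m)) ^ p⁻¹ * r = (2 * e / A) ^ p⁻¹ * r ^ (1 - m / p) := by
  have h1 : (2 * e / (A * r ^ m)) = 2 * e / A * r ^ (-(m : ℝ)) := by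
    rw [Real.rpow_neg hr.le, Real.rpow_natCast]
    field_simp
  rw [h1, Real.mul_rpow (by positivity) (by positivity), ← Real.rpow_mul hr.le, mul_assoc]
  congr 1
  nth_rewrite 2 [← Real.rpow_one r]
  rw [← Real.rpow_add hr]
  congr 1
  ring

theorem norm_sub_starProjection_le_of_tangentPointRadius {z y : EuclideanSpace ℝ (Fin n)}
    {P : Submodule ℝ (EuclideanSpace ℝ (Fin n))} {Λ : ℝ} (hΛ : 0 ≤ Λ)
    (h : (tangentPointRadius z y P)⁻¹ ≤ ENNReal.ofReal Λ) :
    ‖(y - z) - P.starProjection (y - z)‖ ≤ Λ * ‖y - z‖ ^ 2 / 2 := by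
  rw [tangentPointRadius] at h
  split_ifs at h with hy
  · obtain ⟨v, hv, rfl⟩ := hy
    simp only [add_sub_cancel_left]
    rw [Submodule.starProjection_eq_self_iff.2 hv, sub_self, norm_zero]
    positivity
  · have hne : y ≠ z := by
      rintro rfl
      exact hy ⟨0, P.zero_mem, add_zero _⟩
    have hpos : 0 < ‖y - z‖ := norm_pos_iff.2 (sub_ne_zero.2 hne)
    have h2 : ∀ t : ℝ, 2 * ENNReal.ofReal t = ENNReal.ofReal (2 * t) := fun t => by
      rw [ENNReal.ofReal_mul two_pos.le, ENNReal.ofReal_ofNat]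
    rw [infEDist_plane, edist_dist, dist_eq_norm, ← ENNReal.ofReal_pow (norm_nonneg _),
      ENNReal.inv_div (Or.inl (by finiteness)) (Or.inr (by simpa using sub_ne_zero.2 hne)),
      ENNReal.div_le_iff (by simpa using sub_ne_zero.2 hne) ENNReal.ofReal_ne_top,
      ← ENNReal.ofReal_mul hΛ, h2, ENNReal.ofReal_le_ofReal_iff (by positivity)] at h
    linarith

/-- The simplex has volume at least `δ^(m+1)` times that of the corner simplex, and diameter at most
`2r`. -/
theorem mul_pow_le_of_simplexCurvature_le {Λ r δ : ℝ} (hΛ : 0 ≤ Λ) (hr : 0 < r) (hδ : 0 ≤ δ)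
    {x z : EuclideanSpace ℝ (Fin n)} {e v : Fin (m + 1) → EuclideanSpace ℝ (Fin n)}
    (he : Orthonormal ℝ e) (hev : ∀ i j, j < i → inner ℝ (e i) (v j) = 0)
    (hv : ∀ i, δ ≤ inner ℝ (e i) (v i)) (hz : z ∈ ball x r) (hzv : ∀ i, z + v i ∈ ball x r)
    (h : simplexCurvature m z (fun i => z + v i) ≤ ENNReal.ofReal Λ) :
    δ ^ (m + 1) * (volume (cornerSimplex (m + 1))).toReal ≤ Λ * (2 * r) ^ (m + 2) := by
  have hdiam : ediam (insert z (range fun i => z + v i)) ≤ ENNReal.ofReal (2 * r) := by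
    have hsub : insert z (range fun i => z + v i) ⊆ ball x r :=
      insert_subset hz (range_subset_iff.2 hzv)
    refine ediam_le fun a ha b hb => ?_
    rw [edist_dist]
    refine ENNReal.ofReal_le_ofReal ((dist_triangle_right a b x).trans ?_)
    linarith [mem_ball.1 (hsub ha), mem_ball.1 (hsub hb)]
  have h1 := le_euclideanHausdorffMeasure_convexHull he hev hδ hv z
  have h2 : ENNReal.ofReal (δ ^ (m + 1)) * volume (cornerSimplex (m + 1)) /
      ENNReal.ofReal (2 * r) ^ (m + 2) ≤ ENNReal.ofReal Λ :=
    (ENNReal.div_le_div h1 (pow_le_pow_left' hdiam _)).trans h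
  rw [ENNReal.div_le_iff (pow_ne_zero _ (by simpa using hr)) (by finiteness),
    ← ENNReal.ofReal_toReal (volume_cornerSimplex_lt_top (m + 1)).ne,
    ← ENNReal.ofReal_mul (by positivity), ← ENNReal.ofReal_pow (by positivity),
    ← ENNReal.ofReal_mul hΛ, ENNReal.ofReal_le_ofReal_iff (by positivity)] at h2
  exact h2

theorem IsFineWith.hasFlatApprox_of_tangentPoint (hS : IsFineWith m A M S) (hd : 0 < diam S)
    {p E κ : ℝ} (hp : 0 < p) (hκ : κ ≤ 1 - m / p)
    {H : EuclideanSpace ℝ (Fin n) → Submodule ℝ (EuclideanSpace ℝ (Fin n))}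
    (hH : ∀ z ∈ S, H z ∈ Gr n m)
    (hE : (∫⁻ z in S, globalTangentPoint S H z ^ p ∂μHE[m]) ≤ ENNReal.ofReal E) :
    HasFlatApprox m κ
      (4 * M * (2 * (2 * max E 1 / A) ^ p⁻¹) * diam S ^ (1 - m / p - κ)) (diam S) S := by
  have hA := hS.A_pos
  have he : 0 < max E 1 := lt_of_lt_of_le one_pos (le_max_right _ _)
  refine hS.hasFlatApprox hd (by positivity) hκ fun x hx r hr hrd => ?_
  obtain ⟨z, ⟨hz, hzx⟩, hzK⟩ := hS.exists_le_of_lintegral_le hp hE hx hr hrd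
  have hΛr := rpow_inv_mul_self (m := m) (p := p) hA hr he
  set Λ := (2 * max E 1 / (A * r ^ m)) ^ p⁻¹
  have hΛ : 0 ≤ Λ := by positivity
  refine ⟨z, H z, hH z hz, fun y hy => ?_⟩
  refine (norm_sub_starProjection_le_of_tangentPointRadius hΛ ((le_iSup₂_of_le
    (f := fun y _ => (tangentPointRadius z y (H z))⁻¹) y hy.1 le_rfl).trans hzK)).trans ?_
  have hyz : ‖y - z‖ ≤ 2 * r := by
    rw [← dist_eq_norm]
    linarith [dist_triangle_right y z x, mem_ball.1 hzx, mem_ball.1 hy.2]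
  calc Λ * ‖y - z‖ ^ 2 / 2 ≤ Λ * (2 * r) ^ 2 / 2 := by gcongr
    _ = 2 * (Λ * r) * r := by ring
    _ = _ := by rw [hΛr]; ring

theorem IsFineWith.hasFlatApprox_of_menger (hmn : m ≤ n) (hS : IsFineWith m A M S)
    (hd : 0 < diam S) {p E κ : ℝ} (hp : 0 < p) (hκ : κ ≤ (1 - m / p) * ((m + 1 : ℕ) : ℝ)⁻¹)
    (hE : (∫⁻ z in S, globalMenger m S z ^ p ∂μHE[m]) ≤ ENNReal.ofReal E) :
    HasFlatApprox m κ
      (4 * M * (2 ^ (m + 3) * (2 * max E 1 / A) ^ p⁻¹ /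
          (volume (cornerSimplex (m + 1))).toReal) ^ ((m + 1 : ℕ) : ℝ)⁻¹ *
        diam S ^ ((1 - m / p) * ((m + 1 : ℕ) : ℝ)⁻¹ - κ)) (diam S) S := by
  have hA := hS.A_pos
  have he : 0 < max E 1 := lt_of_lt_of_le one_pos (le_max_right _ _)
  have hc : 0 < (volume (cornerSimplex (m + 1))).toReal :=
    ENNReal.toReal_pos (volume_cornerSimplex_pos _).ne' (volume_cornerSimplex_lt_top _).ne
  refine hS.hasFlatApprox hd (by positivity) hκ fun x hx r hr hrd => ?_
  obtain ⟨z, ⟨hz, hzx⟩, hzK⟩ := hS.exists_le_of_lintegral_le hp hE hx hr hrd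
  have hΛr := rpow_inv_mul_self (m := m) (p := p) hA hr he
  set Λ := (2 * max E 1 / (A * r ^ m)) ^ p⁻¹
  set Q := (2 * max E 1 / A) ^ p⁻¹
  set c := (volume (cornerSimplex (m + 1))).toReal
  have hΛ : 0 < Λ := by positivity
  have hQ : 0 < Q := by positivity
  refine ⟨z, ?_⟩
  by_contra! hcon
  obtain ⟨e, v, h1, h2, h3, h4⟩ := exists_orthonormal_of_forall_plane (m := m)
    (by simpa using hmn) (T := S ∩ ball x r) (z := z) (by positivity) hcon
  have h5 := mul_pow_le_of_simplexCurvature_le hΛ.le hr (by positivity) h1 h2 h3 hzx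
    (fun i => (h4 i).2) ((le_iSup₂_of_le (f := fun y (_ : ∀ i, y i ∈ S) => simplexCurvature m z y)
      _ (fun i => (h4 i).1) le_rfl).trans hzK)
  -- The threshold `δ` is chosen so that `δ^(m+1) c = 2Λ(2r)^(m+2)`, twice what the curvature bound
  -- allows; hence `2^(m+3)`.
  have h6 : ((2 ^ (m + 3) * Q / c) ^ ((m + 1 : ℕ) : ℝ)⁻¹ *
      r ^ ((1 - m / p) * ((m + 1 : ℕ) : ℝ)⁻¹) * r) ^ (m + 1) =
      2 ^ (m + 3) * (Λ * r) / c * r ^ (m + 1) := by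
    rw [mul_pow, mul_pow, Real.rpow_inv_natCast_pow (by positivity) (by omega),
      Real.rpow_mul hr.le, Real.rpow_inv_natCast_pow (by positivity) (by omega), hΛr]
    ring
  rw [h6] at h5
  have h7 : 2 ^ (m + 3) * (Λ * r) / c * r ^ (m + 1) * c = 2 * (Λ * (2 * r) ^ (m + 2)) := by
    field_simp
    ring
  have : 0 < Λ * (2 * r) ^ (m + 2) := by positivity
  linarith

end Decay

/-! ### The Hölder exponents -/

section Exponents

variable {m : ℕ} {p : ℝ}

theorem kappaMenger_pos (hp : (m : ℝ) < p) : 0 < kappaMenger m p := by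
  have hp0 : 0 < p := (Nat.cast_nonneg m).trans_lt hp
  rw [kappaMenger, Real.toNNReal_pos]
  exact div_pos (sub_pos.2 hp) (by positivity)

theorem coe_kappaMenger_le (hp : (m : ℝ) < p) :
    (kappaMenger m p : ℝ) ≤ (1 - m / p) * ((m + 1 : ℕ) : ℝ)⁻¹ := by
  have hp0 : 0 < p := (Nat.cast_nonneg m).trans_lt hp
  have h0 : 0 < p - m := sub_pos.2 hp
  rw [kappaMenger, Real.coe_toNNReal _ (by positivity)]
  have : (1 - m / p) * ((m + 1 : ℕ) : ℝ)⁻¹ = (p - m) / (p * (m + 1)) := by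
    push_cast
    field_simp
  rw [this]
  gcongr
  linarith [Nat.cast_nonneg (α := ℝ) m]

theorem kappaMenger_le_one (hp : (m : ℝ) < p) : kappaMenger m p ≤ 1 := by
  have hp0 : 0 < p := (Nat.cast_nonneg m).trans_lt hp
  rw [kappaMenger, Real.toNNReal_le_one, div_le_one (by positivity)]
  nlinarith [Nat.cast_nonneg (α := ℝ) m]

theorem kappaTangentPoint_pos (hp : (m : ℝ) < p) : 0 < kappaTangentPoint m p := by
  have hp0 : 0 < p := (Nat.cast_nonneg m).trans_lt hp
  rw [kappaTangentPoint, Real.toNNReal_pos]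
  exact div_pos (sub_pos.2 hp) (by positivity)

theorem coe_kappaTangentPoint_le (hp : (m : ℝ) < p) :
    (kappaTangentPoint m p : ℝ) ≤ 1 - m / p := by
  have hp0 : 0 < p := (Nat.cast_nonneg m).trans_lt hp
  have h0 : 0 < p - m := sub_pos.2 hp
  rw [kappaTangentPoint, Real.coe_toNNReal _ (by positivity), one_sub_div hp0.ne']
  gcongr
  linarith [Nat.cast_nonneg (α := ℝ) m]

theorem kappaTangentPoint_le_one (hp : (m : ℝ) < p) : kappaTangentPoint m p ≤ 1 := by
  have hp0 : 0 < p := (Nat.cast_nonneg m).trans_lt hp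
  rw [kappaTangentPoint, Real.toNNReal_le_one, div_le_one (by positivity)]
  linarith [Nat.cast_nonneg (α := ℝ) m]

end Exponents

end FineSets

/-! ### The main theorem -/

theorem mainTheorem7 (n m : ℕ) (hm : 0 < m) (hmn : m < n) (p : ℝ) (hp : (m : ℝ) < p)
    (A M E d : ℝ) (hd : 0 < d) :
    ∃ R K : ℝ, 0 < R ∧ 0 < K ∧
      ∀ S : Set (EuclideanSpace ℝ (Fin n)), FineSets.IsFineWith m A M S → Metric.diam S = d →
        ((∫⁻ z in S, FineSets.globalMenger m S z ^ p ∂μHE[m]) ≤ ENNReal.ofReal E →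
          FineSets.IsClosedC1HolderManifold m (FineSets.kappaMenger m p) S ∧
          ∀ x ∈ S, FineSets.HasGraphPatch m (FineSets.kappaMenger m p) R K S x) ∧
        (∀ H : EuclideanSpace ℝ (Fin n) → Submodule ℝ (EuclideanSpace ℝ (Fin n)),
          (∀ z ∈ S, H z ∈ FineSets.Gr n m) →
          (∫⁻ z in S, FineSets.globalTangentPoint S H z ^ p ∂μHE[m]) ≤ ENNReal.ofReal E →
          FineSets.IsClosedC1HolderManifold m (FineSets.kappaTangentPoint m p) S ∧
          ∀ x ∈ S, FineSets.HasGraphPatch m (FineSets.kappaTangentPoint m p) R K S x) := by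
  have hp0 : 0 < p := (Nat.cast_nonneg m).trans_lt hp
  have he : 0 < max E 1 := lt_of_lt_of_le one_pos (le_max_right _ _)
  -- For other constants there are no fine sets, so any `R` and `K` serve.
  by_cases hAM : 0 < A ∧ 2 ≤ M
  swap
  · exact ⟨1, 1, one_pos, one_pos, fun S hS => absurd ⟨hS.A_pos, hS.two_le_M⟩ hAM⟩
  obtain ⟨hA, hM2⟩ := hAM
  have hM : 0 < M := by linarith
  obtain ⟨R₁, K₁, hR₁, hK₁, h₁⟩ := FineSets.exists_hasGraphPatch n m
    (FineSets.kappaMenger_pos hp) (FineSets.kappaMenger_le_one hp)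
    (C := 4 * M * (2 ^ (m + 3) * (2 * max E 1 / A) ^ p⁻¹ /
          (volume (FineSets.cornerSimplex (m + 1))).toReal) ^ ((m + 1 : ℕ) : ℝ)⁻¹ *
        d ^ ((1 - m / p) * ((m + 1 : ℕ) : ℝ)⁻¹ - FineSets.kappaMenger m p)) (by positivity) hd
  obtain ⟨R₂, K₂, hR₂, hK₂, h₂⟩ := FineSets.exists_hasGraphPatch n m
    (FineSets.kappaTangentPoint_pos hp) (FineSets.kappaTangentPoint_le_one hp)
    (C := 4 * M * (2 * (2 * max E 1 / A) ^ p⁻¹) *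
      d ^ (1 - m / p - FineSets.kappaTangentPoint m p)) (by positivity) hd
  have hR : 0 < min R₁ R₂ := lt_min hR₁ hR₂
  -- One pair serves both curvatures, since patches exist for all smaller radii and all larger
  -- bounds.
  refine ⟨min R₁ R₂, max K₁ K₂, hR, lt_max_of_lt_left hK₁, fun S hS hdS => ?_⟩
  subst hdS
  refine ⟨fun hE => ?_, fun H hH hE => ?_⟩
  · have hpatch := h₁ _ _ (min_le_left _ R₂) (le_max_left _ K₂) S hS.isCompact
      (hS.hasFlatApprox_of_menger hmn.le hd hp0 (FineSets.coe_kappaMenger_le hp) hE)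
    exact ⟨FineSets.isClosedC1HolderManifold_of_hasGraphPatch hS.isCompact hR hpatch, hpatch⟩
  · have hpatch := h₂ _ _ (min_le_right R₁ _) (le_max_right K₁ _) S hS.isCompact
      (hS.hasFlatApprox_of_tangentPoint hd hp0 (FineSets.coe_kappaTangentPoint_le hp) hH hE)
    exact ⟨FineSets.isClosedC1HolderManifold_of_hasGraphPatch hS.isCompact hR hpatch, hpatch⟩
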